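/- Strings are finite binary strings; $|x|$ is the length of the string $x$, $|A|$ is the cardinality of the finite set $A$, $\log$ is the binary logarithm, and $\log 0$ is read as $0$. Fix a reference machine $U$: a partial computable function from strings to strings such that for every partial computable $V$ there is a constant $c_V$ such that whenever $V(p)=x$ there is $q$ with $|q|\le |p|+c_V$ and $U(q)=x$. The (plain) Kolmogorov complexity $C(x)$ of a string is $\min\{|p| : U(p)=x\}$. The complexity $C(A)$ of a finite set $A$ of strings is the length of a shortest program on which $U$ prints the list of all elements of $A$ in a fixed computable order and halts (the list being encoded as a string in a fixed computable way). For a finite family $\mathcal F$ of finite sets of strings, $C(\mathcal F)=C(\{\phi(A):A\in\mathcal F\})$, where $\phi$ is a fixed computable bijection from the finite sets of strings to the strings. A distortion family is a set $\mathcal A$ of finite nonempty sets of strings; put $\mathcal A_n=\{A\in\mathcal A: A\subseteq\{0,1\}^n\}$. The canonical rate-distortion function of a string $x$ is $$g_x(l)=\min\{C(B): x\in B\in\mathcal A,\ \log|B|\le l\}.$$ Let $G_n$ be the class of functions $g:\{0,1,\dots,n\}\to\mathbb N$ with $g(n)=0$ and $g(l-1)\in\{g(l),g(l)+1\}$ for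 $1\le l\le n$ (equivalently: $g$ is nonincreasing, $g(l)+l$ is nondecreasing, and $g(n)=0$). **Theorem.** Let $\mathcal A$ be a distortion family with the following four properties. 1. $\{0,1\}^n\in\mathcal A$ for every natural number $n$. 2. All elements of any one $A\in\mathcal A$ have the same length. 3. $C(\mathcal A_n)=O(\log n)$. 4. There is a polynomial $\alpha$ such that for every $n$, every $A\in\mathcal A_n$ and every positive integer $c\le|A|$, the set $A$ can be covered by at most $\alpha(n)|A|/c$ sets $B\in\mathcal A$ with $|B|\le c$. Then: (i) For every $n$ and every string $x$ of length $n$ there is $g\in G_n$ such that $g_x(l)=g(l)+O(\log n)$ for every $l=0,\dots,n$. (ii) Conversely, for every $n$ and every $g\in G_n$ there is a string $x$ of length $n$ such that $g_x(l)=g(l)+O(\sqrt{n\log n})$ for every $l=0,\dots,n$. Here $u=v+O(f(n))$ means $|u-v|\le c f(n)+c$ (and $u=O(f(n))$ means $u\le cf(n)+c$) with a constant $c$; in (i) and (ii) the constant depends only on $U$ and $\mathcal A$, not on $n$, $x$, $g$, $l$. -/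

import Mathlib

namespace RateDistortion

/-- Finite binary strings (`false` is the bit 0, `true` is the bit 1). -/
abbrev Str := List Bool

/-! ### Strings, numbers and finite sets of strings -/

/-- The correspondence `ε, 0, 1, 00, 01, 10, … ↦ 0, 1, 2, 3, 4, 5, …` between strings and
natural numbers (length-increasing lexicographic order). -/
def strToNat (s : Str) : ℕ := s.foldl (fun a b => 2 * a + 1 + b.toNat) 0

/-- The inverse correspondence: the binary expansion of `n + 1`, most significant bit first,
without its leading `1`. -/
def natToStr (n : ℕ) : Str := (n + 1).bits.dropLast.reverse

theorem strToNat_concat (s : Str) (b : Bool) :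
    strToNat (s ++ [b]) = 2 * strToNat s + 1 + b.toNat := by
  simp [strToNat]

theorem natToStr_concat (k : ℕ) (b : Bool) :
    natToStr (2 * k + 1 + b.toNat) = natToStr k ++ [b] := by
  have h : (k + 1).bits ≠ [] := by
    intro h
    have h' := congrArg List.length h
    rw [Nat.size_eq_bits_len, List.length_nil, Nat.size_eq_zero] at h'
    omega
  have e : 2 * k + 1 + b.toNat + 1 = Nat.bit b (k + 1) := by
    cases b <;> simp [Nat.bit] <;> ring
  unfold natToStr
  rw [e, Nat.bits_append_bit _ _ (by simp), List.dropLast_cons_of_ne_nil h, List.reverse_cons]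

theorem natToStr_strToNat (s : Str) : natToStr (strToNat s) = s := by
  induction s using List.reverseRecOn with
  | nil => simp [strToNat, natToStr]
  | append_singleton s b ih => rw [strToNat_concat, natToStr_concat, ih]

theorem strToNat_natToStr (n : ℕ) : strToNat (natToStr n) = n := by
  induction n using Nat.strong_induction_on with
  | _ n ih =>
    rcases Nat.eq_zero_or_pos n with rfl | hn
    · simp [strToNat, natToStr]
    · obtain ⟨k, b, hk, rfl⟩ : ∃ k, ∃ b : Bool, k < n ∧ n = 2 * k + 1 + b.toNat := by
        rcases Nat.even_or_odd' (n - 1) with ⟨k, hk | hk⟩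
        · exact ⟨k, false, by omega, by simp; omega⟩
        · exact ⟨k, true, by omega, by simp; omega⟩
      rw [natToStr_concat, strToNat_concat, ih k hk]

/-- `{0,1}^n`. -/
def cube (n : ℕ) : Finset Str := (Finset.univ : Finset (Fin n → Bool)).image List.ofFn

theorem mem_cube {n : ℕ} {x : Str} : x ∈ cube n ↔ x.length = n := by
  constructor
  · intro h
    obtain ⟨f, -, rfl⟩ := Finset.mem_image.1 h
    simp
  · rintro rfl
    exact Finset.mem_image.2 ⟨x.get, Finset.mem_univ _, List.ofFn_get x⟩

/-- The list of all elements of a finite set of strings, in the order fixed by `strToNat`;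
the elements are written as the corresponding numbers. -/
def listing (A : Finset Str) : List ℕ := (A.image strToNat).sort (· ≤ ·)

/-- The listing of a finite set, printed as one string from which the list can be recovered. -/
def printed (A : Finset Str) : Str := natToStr (Encodable.encode (listing A))

/-- A computable bijection between finite sets of strings and strings. -/
def setCode (A : Finset Str) : Str := natToStr (∑ a ∈ A, 2 ^ strToNat a)

theorem setCode_bijective : Function.Bijective setCode := by
  have e : Function.Bijective strToNat :=
    ⟨Function.LeftInverse.injective natToStr_strToNat,
      Function.RightInverse.surjective strToNat_natToStr⟩
  have e' : Function.Bijective natToStr :=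
    ⟨Function.LeftInverse.injective strToNat_natToStr,
      Function.RightInverse.surjective natToStr_strToNat⟩
  have h : setCode = natToStr ∘ Finset.equivBitIndices.symm ∘
      (Equiv.finsetCongr (Equiv.ofBijective _ e)) := by
    funext A
    simp [setCode, Finset.equivBitIndices]
  rw [h]
  exact e'.comp ((Equiv.bijective _).comp (Equiv.bijective _))

/-! ### Kolmogorov complexity -/

/-- `U` is a reference machine: it is partial computable, and it is additively optimal, that is,
every partial computable function is simulated by `U` with programs that are longer by at most
a constant. (A machine with auxiliary input is used with empty auxiliary input.) -/
def IsReferenceMachine (U : Str →. Str) : Prop :=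
  Partrec U ∧ ∀ V : Str →. Str, Partrec V →
    ∃ c : ℕ, ∀ p x : Str, x ∈ V p → ∃ q : Str, q.length ≤ p.length + c ∧ x ∈ U q

/-- The plain Kolmogorov complexity `C(x)` of a string: the length of a shortest program for
`x`. -/
noncomputable def complexity (U : Str →. Str) (x : Str) : ℕ :=
  sInf {k | ∃ p : Str, p.length = k ∧ x ∈ U p}

/-- The Kolmogorov complexity `C(A)` of a finite set of strings: the length of a shortest program
that prints the list of all elements of `A` in the fixed order and halts. -/
noncomputable def setComplexity (U : Str →. Str) (A : Finset Str) : ℕ :=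
  complexity U (printed A)

/-- The Kolmogorov complexity of a finite family of finite sets of strings: the complexity of
the finite set of the codes of its members. -/
noncomputable def familyComplexity (U : Str →. Str) (F : Finset (Finset Str)) : ℕ :=
  setComplexity U (F.image setCode)

/-- Reference machines exist. -/
theorem exists_isReferenceMachine : ∃ U, IsReferenceMachine U := by
  let f : Str → ℕ := fun p => p.findIdx (fun b => !b)
  let W : Str →. ℕ := fun p =>
    (Denumerable.ofNat Nat.Partrec.Code (f p)).eval (Encodable.encode (p.drop (f p + 1)))
  have hf : Primrec f := Primrec.list_findIdx Primrec.id (Primrec.not.comp Primrec.snd).to₂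
  have hW : Partrec W :=
    Nat.Partrec.Code.eval_part.comp ((Primrec.ofNat _).comp hf).to_comp
      (Primrec.encode.comp
        (Primrec.list_drop.comp (Primrec.succ.comp hf) Primrec.id)).to_comp
  refine ⟨fun p => (W p).bind fun m => (Encodable.decode (α := Str) m : Option Str),
    hW.bind (Computable.ofOption (Computable.decode.comp Computable.snd)).to₂, ?_⟩
  intro V hV
  obtain ⟨e, he⟩ := Nat.Partrec.Code.exists_code.1 hV
  refine ⟨Encodable.encode e + 1, fun p x hx =>
    ⟨List.replicate (Encodable.encode e) true ++ false :: p, by simp; omega, ?_⟩⟩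
  have h1 : f (List.replicate (Encodable.encode e) true ++ false :: p) = Encodable.encode e := by
    simp [f, List.findIdx_append, List.findIdx_cons, List.findIdx_eq_length_of_false]
  have h2 : (List.replicate (Encodable.encode e) true ++ false :: p).drop
      (Encodable.encode e + 1) = p := by
    simp [List.drop_append]
  refine Part.mem_bind_iff.2 ⟨Encodable.encode x, ?_, by simp⟩
  simp only [W, h1, h2, Denumerable.ofNat_encode, he]
  simpa using hx

/-! ### Distortion families -/

/-- A distortion family: a set of finite nonempty sets of strings. -/
def IsDistortionFamily (𝒜 : Set (Finset Str)) : Prop := ∀ A ∈ 𝒜, A.Nonempty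

open Classical in
/-- `𝒜_n`, the members of `𝒜` that consist of strings of length `n`. -/
noncomputable def slice (𝒜 : Set (Finset Str)) (n : ℕ) : Finset (Finset Str) :=
  (cube n).powerset.filter (· ∈ 𝒜)

/-- `𝒜` contains `{0,1}^n` for every `n`. -/
def ContainsCubes (𝒜 : Set (Finset Str)) : Prop := ∀ n : ℕ, cube n ∈ 𝒜

/-- Any two strings in the same member of `𝒜` have the same length. -/
def EqualLengths (𝒜 : Set (Finset Str)) : Prop :=
  ∀ A ∈ 𝒜, ∀ x ∈ A, ∀ y ∈ A, x.length = y.length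

/-- `C(𝒜_n) = O(log n)`. -/
def SimpleSlices (U : Str →. Str) (𝒜 : Set (Finset Str)) : Prop :=
  ∃ c : ℝ, ∀ n : ℕ, (familyComplexity U (slice 𝒜 n) : ℝ) ≤ c * Real.logb 2 n + c

/-- The covering coefficient of `𝒜_n` is at most `α`: for every positive integer `c`, every
`A ∈ 𝒜_n` with at least `c` elements is covered by at most `α |A| / c` members of `𝒜` of
cardinality at most `c`. (A set with fewer than `c` elements covers itself; a single set is then
needed, however large `c` is.) -/
def CoveringCoeffLE (𝒜 : Set (Finset Str)) (n : ℕ) (α : ℝ) : Prop :=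
  ∀ c : ℕ, 0 < c → ∀ A ∈ slice 𝒜 n, c ≤ A.card →
    ∃ ℬ : Finset (Finset Str), (∀ B ∈ ℬ, B ∈ 𝒜 ∧ B.card ≤ c) ∧ (∀ x ∈ A, ∃ B ∈ ℬ, x ∈ B) ∧
      (ℬ.card : ℝ) ≤ α * A.card / c

/-- The covering coefficient of `𝒜_n` is bounded by a polynomial in `n`. -/
def PolynomialCovering (𝒜 : Set (Finset Str)) : Prop :=
  ∃ P : Polynomial ℝ, ∀ n : ℕ, CoveringCoeffLE 𝒜 n (P.eval (n : ℝ))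

/-- The canonical rate-distortion function
`g_x(l) = min {C(B) : x ∈ B ∈ 𝒜, log₂ |B| ≤ l}`. -/
noncomputable def canonicalRD (U : Str →. Str) (𝒜 : Set (Finset Str)) (x : Str) (l : ℕ) : ℕ :=
  sInf {k | ∃ B ∈ 𝒜, x ∈ B ∧ B.card ≤ 2 ^ l ∧ setComplexity U B = k}

/-- The class `G_n` of functions `g : {0, …, n} → ℕ` with `g(n) = 0` and
`g(l - 1) ∈ {g(l), g(l) + 1}` for `1 ≤ l ≤ n`. -/
def shapes (n : ℕ) : Set (Fin (n + 1) → ℕ) :=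
  {g | g (Fin.last n) = 0 ∧
    ∀ l : Fin n, g l.castSucc = g l.succ ∨ g l.castSucc = g l.succ + 1}

end RateDistortion

open RateDistortion

/-! ### Computability of the string coding and of some list operations -/

/-! For (i), let `B` be optimal for `x` at `m` and let `l ≤ m`. Cover `B` by `poly(n) * 2 ^ (m - l)`
members of the slice of size at most `2 ^ l`. Programs for `B` and for the slice suffice to find
such a cover by search, so naming its member that contains `x` costs `m - l + O(log n)` more bits
(`exists_mem_cover_complexity_le`, `exists_canonicalRD_le_add`). Hence the rate-distortion function
is nonincreasing, is `O(log n)` at `n`, and has slope at least `-1` up to `O(log n)`;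
`exists_shape_close` rounds it to a shape.

For (ii), only the levels `ℓ j = n - j * d`, `j ≤ M`, with `d` about `√(n log n)`, are controlled;
monotonicity and the slope bound fill the gaps. Enumerate the sets in the slice of size at most `2 ^
ℓ j` and complexity below `g (ℓ j) - δ`, and remove their elements. A string that is never removed
obeys the lower bound at every level.

For the upper bound, choose alongside sets `A_1, A_2, …` of the slice, `A_j` of size at most `2 ^ ℓ
j`, so that `A_1 ∩ … ∩ A_j` keeps `2 ^ t j` surviving strings, where `t j = ℓ j - a * j - 1` and `2
^ a` bounds the covering loss. Averaging over a cover gives an `A_j` with twice as many survivors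
(`HasCovers.exists_rich`), so it can be kept until `2 ^ t j` of them are lost. Removed sets of
levels up to `j` are few, and each may force a new choice; those of finer levels have few elements
in total, because `g(l) + l` is nondecreasing. So `A_j`, including changes inherited from earlier
levels, changes at most `2 ^ g (ℓ j)` times once `δ ≥ a * M + 2 log M + O(1)`
(`IsLevelData.clock_le`). The count of changes and `O(M log n)` bits describing the levels determine
the final `A_j` (`exists_chainMember_complexity_le`). Any final survivor in the intersection is the
required string. The errors `d`, `a * M`, `δ` and `M log n` are all `O(√(n log n))`. -/

theorem primrec_strToNat : Primrec strToNat := by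
  refine Primrec.list_foldl Primrec.id (Primrec.const 0)
    (h := fun _ (p : ℕ × Bool) => 2 * p.1 + 1 + p.2.toNat) ?_
  exact (Primrec.nat_add.comp (Primrec.succ.comp (Primrec.nat_mul.comp (Primrec.const 2)
    (Primrec.fst.comp Primrec.snd))) ((Primrec.dom_bool Bool.toNat).comp
      (Primrec.snd.comp Primrec.snd))).to₂

theorem natToStr_zero : natToStr 0 = [] := by simp [natToStr]

theorem natToStr_succ (n : ℕ) :
    natToStr (n + 1) = natToStr (n / 2) ++ [decide (n % 2 = 1)] := by
  have := natToStr_concat (n / 2) (decide (n % 2 = 1))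
  rw [← this]
  congr 1
  rcases Nat.mod_two_eq_zero_or_one n with h | h <;> simp [h] <;> omega

theorem primrec_natToStr : Primrec natToStr := by
  have key : Primrec₂ (fun (_ : Unit) (n : ℕ) => natToStr n) := by
    -- `l` holds the values at all smaller arguments, so its length is the current argument.
    refine Primrec.nat_strong_rec _ (g := fun _ (l : List Str) =>
      if l.length = 0 then some [] else
        (l[(l.length - 1) / 2]?).map (fun s => s ++ [decide ((l.length - 1) % 2 = 1)])) ?_ ?_
    · have hl : Primrec (fun p : Unit × List Str => p.2.length - 1) :=
        Primrec.pred.comp (Primrec.list_length.comp Primrec.snd)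
      have ha : Primrec₂ (fun (p : Unit × List Str) (s : Str) =>
          s ++ [decide ((p.2.length - 1) % 2 = 1)]) :=
        Primrec.list_concat.comp Primrec.snd (Primrec.eq.comp (Primrec.nat_mod.comp
          (hl.comp Primrec.fst) (Primrec.const 2)) (Primrec.const 1)).decide
      exact (Primrec.ite (Primrec.eq.comp (Primrec.list_length.comp Primrec.snd)
        (Primrec.const 0)) (Primrec.const (some ([] : Str))) (Primrec.option_map
          (Primrec.list_getElem?.comp Primrec.snd
            (Primrec.nat_div.comp hl (Primrec.const 2))) ha)).to₂
    · rintro - n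
      rcases n with _ | n
      · simp [natToStr_zero]
      · have : n / 2 < n + 1 := by omega
        simp [natToStr_succ, List.getElem?_range this]
  exact key.comp (Primrec.const ()) Primrec.id

theorem Primrec.nat_pow : Primrec₂ (fun a b : ℕ => a ^ b) :=
  Primrec₂.unpaired'.1 Nat.Primrec.pow

theorem length_natToStr (n : ℕ) : 2 ^ (natToStr n).length ≤ n + 1 ∧
    n + 1 < 2 ^ ((natToStr n).length + 1) := by
  induction n using Nat.strong_induction_on with
  | _ n ih =>
    rcases n with _ | n
    · simp [natToStr_zero]
    · rw [natToStr_succ]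
      have := ih (n / 2) (by omega)
      simp only [List.length_append, List.length_singleton]
      rw [pow_succ] at *
      omega

theorem length_strToNat (s : Str) : 2 ^ s.length ≤ strToNat s + 1 ∧
    strToNat s + 1 < 2 ^ (s.length + 1) := by
  have := length_natToStr (strToNat s)
  rwa [natToStr_strToNat] at this

theorem length_natToStr_le_size (n : ℕ) : (natToStr n).length ≤ n.size := by
  have h1 := (length_natToStr n).1
  have h2 := Nat.lt_size_self n
  exact (Nat.pow_le_pow_iff_right (by norm_num : 1 < 2)).1 (by omega)

theorem Primrec.list_filter_rel {α β : Type*} [Primcodable α] [Primcodable β] {f : α → List β}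
    {p : α → β → Prop} [DecidableRel p] (hf : Primrec f) (hp : PrimrecRel p) :
    Primrec fun a => (f a).filter (fun b => decide (p a b)) := by
  have := Primrec.listFilterMap hf (g := fun a b => if p a b then some b else none)
    (Primrec.ite (hp.comp Primrec.fst Primrec.snd) (Primrec.option_some.comp Primrec.snd)
      (Primrec.const none)).to₂
  refine this.of_eq fun a => ?_
  rw [← List.filterMap_eq_filter]
  congr 1
  funext b
  by_cases h : p a b <;> simp [Option.guard, h]

theorem Primrec.list_mem {β : Type*} [Primcodable β] [DecidableEq β] :
    PrimrecRel (fun (b : β) (l : List β) => b ∈ l) := by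
  have h : PrimrecRel (fun (l : List β) (b : β) => ∃ a ∈ l, a = b) :=
    PrimrecRel.exists_mem_list (Primrec.eq)
  exact (h.swap).of_eq fun a l => by simp [Function.swap]

theorem PrimrecPred.forall_mem {α β : Type*} [Primcodable α] [Primcodable β] {f : α → List β}
    {p : α → β → Prop} (hf : Primrec f) (hp : PrimrecRel p) :
    PrimrecPred fun a => ∀ b ∈ f a, p a b := by
  have h := PrimrecRel.forall_mem_list (R := fun (b : β) (a : α) => p a b) hp.swap
  exact h.comp hf Primrec.id

theorem PrimrecPred.exists_mem {α β : Type*} [Primcodable α] [Primcodable β] {f : α → List β}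
    {p : α → β → Prop} (hf : Primrec f) (hp : PrimrecRel p) :
    PrimrecPred fun a => ∃ b ∈ f a, p a b := by
  have h := PrimrecRel.exists_mem_list (R := fun (b : β) (a : α) => p a b) hp.swap
  exact h.comp hf Primrec.id

/-! ### Descriptions of bounded length -/

/-- A self-delimiting form of the number `a`. -/
def selfDelim (a : ℕ) : Str := (natToStr a).flatMap (fun b => [true, b]) ++ [false, true]

/-- A list of self-delimited parameters followed by a number written plainly. -/
def packed (z : List ℕ × ℕ) : Str := z.1.flatMap selfDelim ++ [false, false] ++ natToStr z.2

theorem primrec_packed : Primrec packed := by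
  have h1 : Primrec selfDelim := by
    refine Primrec.list_append.comp (Primrec.list_flatMap primrec_natToStr ?_) (Primrec.const _)
    exact (Primrec.list_cons.comp (Primrec.const true)
      (Primrec.list_cons.comp Primrec.snd (Primrec.const []))).to₂
  exact Primrec.list_append.comp (Primrec.list_append.comp
    (Primrec.list_flatMap Primrec.fst (h1.comp Primrec.snd).to₂) (Primrec.const _))
    (primrec_natToStr.comp Primrec.snd)

theorem natToStr_injective : Function.Injective natToStr :=
  Function.LeftInverse.injective strToNat_natToStr

/-- Each digit is preceded by `true` and the block ends with `false, true`, so the code is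
prefix-free. The pair `false, false` stays free to end the parameter list in `packed`. -/
theorem selfDelim_append_inj {a b : ℕ} {r s : Str} (h : selfDelim a ++ r = selfDelim b ++ s) :
    a = b ∧ r = s := by
  have key : ∀ u v : Str, (u.flatMap (fun b => [true, b]) ++ [false, true]) ++ r =
      (v.flatMap (fun b => [true, b]) ++ [false, true]) ++ s → u = v ∧ r = s := by
    intro u
    induction u with
    | nil => intro v hv; cases v <;> simp_all
    | cons x u ih =>
      intro v hv
      cases v with
      | nil => simp at hv
      | cons y v =>
        simp only [List.flatMap_cons, List.cons_append, List.nil_append, List.cons.injEq,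
          true_and] at hv
        obtain ⟨h1, h2⟩ := ih v hv.2
        exact ⟨by rw [hv.1, h1], h2⟩
  obtain ⟨h1, h2⟩ := key _ _ h
  exact ⟨natToStr_injective h1, h2⟩

theorem packed_injective : Function.Injective packed := by
  rintro ⟨ps, q⟩ ⟨ps', q'⟩ h
  have hne : ∀ (a : ℕ) (r s : Str), selfDelim a ++ r ≠ false :: false :: s := by
    intro a r s
    unfold selfDelim
    cases natToStr a <;> simp
  induction ps generalizing ps' with
  | nil =>
    cases ps' with
    | nil => simpa [packed, natToStr_injective.eq_iff] using h
    | cons b ps' =>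
      simp only [packed, List.flatMap_nil, List.flatMap_cons, List.append_assoc] at h
      exact absurd h.symm (hne _ _ _)
  | cons a ps ih =>
    cases ps' with
    | nil =>
      simp only [packed, List.flatMap_nil, List.flatMap_cons, List.append_assoc] at h
      exact absurd h (hne _ _ _)
    | cons b ps' =>
      simp only [packed, List.flatMap_cons, List.append_assoc] at h
      obtain ⟨h1, h2⟩ := selfDelim_append_inj h
      have := ih ps' (by simpa [packed] using h2)
      simp_all

theorem length_packed_le (ps : List ℕ) (q : ℕ) :
    (packed (ps, q)).length ≤ q.size + (ps.map fun a => 2 * a.size + 2).sum + 2 := by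
  have h1 : ∀ a, (selfDelim a).length ≤ 2 * a.size + 2 := by
    intro a
    have := length_natToStr_le_size a
    have h : ∀ u : Str, (u.flatMap (fun b => [true, b])).length = 2 * u.length := by
      intro u
      induction u with
      | nil => rfl
      | cons x u ih => simp only [List.flatMap_cons, List.length_append, ih,
          List.length_cons, List.length_nil]; omega
    simp only [selfDelim, List.length_append, h, List.length_cons, List.length_nil]
    omega
  have h2 : (ps.flatMap selfDelim).length ≤ (ps.map fun a => 2 * a.size + 2).sum := by
    rw [List.length_flatMap]
    exact List.sum_le_sum fun a _ => h1 a
  have := length_natToStr_le_size q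
  simp only [packed, List.length_append, List.length_cons, List.length_nil]
  omega

theorem complexity_le_of_mem {U : Str →. Str} {p x : Str} (h : x ∈ U p) :
    complexity U x ≤ p.length := Nat.sInf_le ⟨p, rfl, h⟩

theorem exists_program {U : Str →. Str} (hU : IsReferenceMachine U) (x : Str) :
    ∃ p : Str, p.length = complexity U x ∧ x ∈ U p := by
  obtain ⟨c, hc⟩ := hU.2 (fun p => Part.some p) Partrec.some
  obtain ⟨q, -, hq⟩ := hc x x (Part.mem_some x)
  exact Nat.sInf_mem (s := {k | ∃ p : Str, p.length = k ∧ x ∈ U p}) ⟨_, q, rfl, hq⟩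

/-- Whatever a fixed machine computes from a list of parameters and a number `q` has complexity
at most the length of `q` plus twice the total length of the parameters. -/
theorem complexity_le_of_partrec {U : Str →. Str} (hU : IsReferenceMachine U)
    {f : List ℕ × ℕ →. ℕ} (hf : Partrec f) : ∃ c : ℕ, ∀ (ps : List ℕ) (q z : ℕ), z ∈ f (ps, q) →
      complexity U (natToStr z) ≤ q.size + (ps.map fun a => 2 * a.size + 2).sum + c := by
  -- The inverse of `packed` by unbounded search; injectivity makes the outcome unique.
  let dec : Str →. List ℕ × ℕ := fun s => Nat.rfindOpt fun k =>
    (Encodable.decode (α := List ℕ × ℕ) k).bind fun z => if packed z = s then some z else none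
  have hdec : Partrec dec := by
    refine Partrec.rfindOpt (Primrec.to_comp ?_)
    have h : PrimrecPred fun a : (Str × ℕ) × (List ℕ × ℕ) => packed a.2 = a.1.1 :=
      Primrec.eq.comp (primrec_packed.comp Primrec.snd) (Primrec.fst.comp Primrec.fst)
    exact Primrec.option_bind (Primrec.decode.comp Primrec.snd)
      (Primrec.ite h (Primrec.option_some.comp Primrec.snd) (Primrec.const none)).to₂
  have hdec' : ∀ z, z ∈ dec (packed z) := by
    intro z
    have hd : (dec (packed z)).Dom :=
      Nat.rfindOpt_dom.2 ⟨Encodable.encode z, z, by rw [Encodable.encodek]; simp⟩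
    obtain ⟨w, hw⟩ := Part.dom_iff_mem.1 hd
    obtain ⟨n, hn⟩ := Nat.rfindOpt_spec hw
    simp only [Option.mem_def, Option.bind_eq_some_iff, Option.ite_none_right_eq_some,
      Option.some.injEq] at hn
    obtain ⟨v, -, hv, rfl⟩ := hn
    rwa [packed_injective hv] at hw
  have hV : Partrec fun s => ((dec s).bind f).map natToStr :=
    (hdec.bind (hf.comp Computable.snd).to₂).map
      (primrec_natToStr.to_comp.comp Computable.snd).to₂
  obtain ⟨c, hc⟩ := hU.2 _ hV
  refine ⟨c + 2, fun ps q z hz => ?_⟩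
  obtain ⟨r, hr, hr'⟩ := hc (packed (ps, q)) (natToStr z)
    (Part.mem_map _ (Part.mem_bind (hdec' _) hz))
  have := complexity_le_of_mem hr'
  have := length_packed_le ps q
  omega

/-- The machine `U` acting on the numbers of strings. -/
def numMachine (U : Str →. Str) : ℕ →. ℕ := fun p => (U (natToStr p)).map strToNat

theorem partrec_numMachine {U : Str →. Str} (hU : Partrec U) : Partrec (numMachine U) :=
  (hU.comp primrec_natToStr.to_comp).map (primrec_strToNat.to_comp.comp Computable.snd).to₂

/-- Strings of length at most `k` are those whose number `p` satisfies `p + 1 < 2 ^ (k + 1)`, so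
program lengths turn into bounds on program numbers. -/
theorem exists_numProgram {U : Str →. Str} (hU : IsReferenceMachine U) (z : ℕ) :
    ∃ p : ℕ, p + 1 < 2 ^ (complexity U (natToStr z) + 1) ∧ z ∈ numMachine U p := by
  obtain ⟨p, hp, hp'⟩ := exists_program hU (natToStr z)
  refine ⟨strToNat p, hp ▸ (length_strToNat p).2, ?_⟩
  rw [numMachine, natToStr_strToNat]
  exact Part.mem_map_iff _ |>.2 ⟨_, hp', strToNat_natToStr z⟩

/-! ### Listings of sets and of families -/

theorem strToNat_injective : Function.Injective strToNat :=
  Function.LeftInverse.injective natToStr_strToNat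

theorem mem_listing {A : Finset Str} {i : ℕ} : i ∈ listing A ↔ natToStr i ∈ A := by
  simp only [listing, Finset.mem_sort, Finset.mem_image]
  constructor
  · rintro ⟨a, ha, rfl⟩
    rwa [natToStr_strToNat]
  · exact fun h => ⟨_, h, strToNat_natToStr i⟩

theorem strToNat_mem_listing {A : Finset Str} {x : Str} : strToNat x ∈ listing A ↔ x ∈ A := by
  rw [mem_listing, natToStr_strToNat]

theorem nodup_listing (A : Finset Str) : (listing A).Nodup := Finset.sort_nodup _ _

theorem length_listing (A : Finset Str) : (listing A).length = A.card := by
  rw [listing, Finset.length_sort, Finset.card_image_of_injective _ strToNat_injective]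

theorem listing_injective : Function.Injective listing := by
  intro A B h
  ext x
  rw [← strToNat_mem_listing, h, strToNat_mem_listing]

theorem eq_listing {A : Finset Str} {l : List ℕ} (hl : l.Pairwise (· < ·))
    (h : ∀ i, i ∈ l ↔ natToStr i ∈ A) : l = listing A := by
  refine List.Perm.eq_of_pairwise' (r := (· ≤ ·)) (hl.imp le_of_lt)
    (Finset.pairwise_sort _ _) ?_
  rw [List.perm_ext_iff_of_nodup (hl.imp ne_of_lt) (nodup_listing A)]
  intro i
  rw [h, mem_listing]

/-- The positions of the binary digits `1` of `m`. -/
def oneBits (m : ℕ) : List ℕ := (List.range m).filter fun i => decide (m / 2 ^ i % 2 = 1)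

theorem primrec_oneBits : Primrec oneBits := by
  refine Primrec.list_filter_rel Primrec.list_range ?_
  exact Primrec.eq.comp (Primrec.nat_mod.comp (Primrec.nat_div.comp Primrec.fst
    (Primrec.nat_pow.comp (Primrec.const 2) Primrec.snd)) (Primrec.const 2)) (Primrec.const 1)

theorem mem_oneBits {m i : ℕ} : i ∈ oneBits m ↔ m.testBit i = true := by
  simp only [oneBits, List.mem_filter, List.mem_range, Nat.testBit_eq_decide_div_mod_eq]
  refine ⟨fun h => h.2, fun h => ⟨?_, h⟩⟩
  by_contra hi
  have h2 : m / 2 ^ i = 0 := Nat.div_eq_of_lt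
    (lt_of_le_of_lt (not_lt.1 hi) i.lt_two_pow_self)
  simp [h2] at h

/-- The complexity of a family is defined through `setCode`; this lets a machine recover the members
from the printed codes. -/
theorem oneBits_setCode (A : Finset Str) : oneBits (strToNat (setCode A)) = listing A := by
  refine eq_listing ((List.pairwise_lt_range).filter _) fun i => ?_
  have h : ∑ a ∈ A, 2 ^ strToNat a = ∑ i ∈ A.image strToNat, 2 ^ i :=
    (Finset.sum_image fun a _ b _ h => strToNat_injective h).symm
  rw [mem_oneBits, setCode, strToNat_natToStr, ← Nat.mem_bitIndices, ← List.mem_toFinset, h,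
    Finset.toFinset_bitIndices_sum_two_pow, ← mem_listing, listing, Finset.mem_sort]

/-- The number whose string is `printed A`. -/
def listCode (A : Finset Str) : ℕ := Encodable.encode (listing A)

/-- The lists coded by the elements of a coded list of bit masks. -/
def familyLists (y : ℕ) : List (List ℕ) :=
  ((Encodable.decode (α := List ℕ) y).getD []).map oneBits

theorem primrec_familyLists : Primrec familyLists :=
  Primrec.list_map (Primrec.option_getD.comp Primrec.decode (Primrec.const []))
    (primrec_oneBits.comp Primrec.snd).to₂

theorem mem_familyLists {F : Finset (Finset Str)} {z : List ℕ} :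
    z ∈ familyLists (listCode (F.image setCode)) ↔ ∃ A ∈ F, listing A = z := by
  simp only [familyLists, listCode, Encodable.encodek, Option.getD_some, List.mem_map]
  constructor
  · rintro ⟨m, hm, rfl⟩
    obtain ⟨A, hA, hA'⟩ := Finset.mem_image.1 (mem_listing.1 hm)
    refine ⟨A, hA, ?_⟩
    rw [← oneBits_setCode, hA', strToNat_natToStr]
  · rintro ⟨A, hA, rfl⟩
    exact ⟨_, strToNat_mem_listing.2 (Finset.mem_image_of_mem _ hA), oneBits_setCode A⟩

theorem listing_mem_familyLists {F : Finset (Finset Str)} {A : Finset Str} :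
    listing A ∈ familyLists (listCode (F.image setCode)) ↔ A ∈ F := by
  rw [mem_familyLists]
  exact ⟨fun ⟨B, hB, h⟩ => listing_injective h ▸ hB, fun h => ⟨A, h, rfl⟩⟩

theorem setComplexity_eq (U : Str →. Str) (A : Finset Str) :
    setComplexity U A = complexity U (natToStr (listCode A)) := rfl

/-- The numbers of the strings of length `n`. -/
def cubeList (n : ℕ) : List ℕ :=
  (List.range (2 ^ (n + 1))).filter fun m => decide (2 ^ n ≤ m + 1 ∧ m + 1 < 2 ^ (n + 1))

theorem primrec_cubeList : Primrec cubeList := by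
  have h2 : Primrec fun n : ℕ => 2 ^ n := Primrec.nat_pow.comp (Primrec.const 2) Primrec.id
  exact Primrec.list_filter_rel (Primrec.list_range.comp (h2.comp Primrec.succ))
    (PrimrecPred.and
      (Primrec.nat_le.comp (h2.comp Primrec.fst) (Primrec.succ.comp Primrec.snd))
      (Primrec.nat_lt.comp (Primrec.succ.comp Primrec.snd)
        (h2.comp (Primrec.succ.comp Primrec.fst))))

theorem length_natToStr_eq_iff {m n : ℕ} :
    (natToStr m).length = n ↔ 2 ^ n ≤ m + 1 ∧ m + 1 < 2 ^ (n + 1) := by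
  have h := length_natToStr m
  constructor
  · rintro rfl; exact h
  · intro h'
    have h1 := (Nat.pow_lt_pow_iff_right (by norm_num : 1 < 2)).1 (h.1.trans_lt h'.2)
    have h2 := (Nat.pow_lt_pow_iff_right (by norm_num : 1 < 2)).1 (h'.1.trans_lt h.2)
    omega

theorem cubeList_eq (n : ℕ) : cubeList n = listing (cube n) := by
  refine eq_listing ((List.pairwise_lt_range).filter _) fun i => ?_
  rw [mem_cube, length_natToStr_eq_iff, cubeList, List.mem_filter, List.mem_range]
  simp only [decide_eq_true_eq]
  exact ⟨fun h => h.2, fun h => ⟨by omega, h⟩⟩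

theorem card_cube (n : ℕ) : (cube n).card = 2 ^ n := by
  rw [cube, Finset.card_image_of_injective _ List.ofFn_injective]
  simp

theorem mem_slice {𝒜 : Set (Finset Str)} {n : ℕ} {A : Finset Str} :
    A ∈ slice 𝒜 n ↔ A ∈ 𝒜 ∧ ∀ x ∈ A, x.length = n := by
  simp only [slice, Finset.mem_filter, Finset.mem_powerset, Finset.subset_iff, mem_cube]
  exact and_comm

theorem mem_slice_of_mem {𝒜 : Set (Finset Str)} (h2 : EqualLengths 𝒜) {A : Finset Str}
    (hA : A ∈ 𝒜) {x : Str} (hx : x ∈ A) : A ∈ slice 𝒜 x.length :=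
  mem_slice.2 ⟨hA, fun _ hy => h2 A hA _ hy _ hx⟩

/-! ### Simple sets: cubes and the members of simple covers -/

theorem setComplexity_cube_le {U : Str →. Str} (hU : IsReferenceMachine U) :
    ∃ c : ℕ, ∀ n : ℕ, setComplexity U (cube n) ≤ n.size + c := by
  have hf : Partrec fun z : List ℕ × ℕ => Part.some (Encodable.encode (cubeList z.2)) :=
    (Primrec.encode.comp (primrec_cubeList.comp Primrec.snd)).to_comp
  obtain ⟨c, hc⟩ := complexity_le_of_partrec hU hf
  refine ⟨c, fun n => ?_⟩
  have := hc [] n (listCode (cube n)) (by rw [listCode, cubeList_eq]; exact Part.mem_some _)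
  simpa [setComplexity_eq] using this

/-- The list `w` of lists from `L` of length at most `2 ^ l` covers `B` and has at most `2 ^ r`
members. -/
def IsListCover (L : List (List ℕ)) (B : List ℕ) (l r : ℕ) (w : List (List ℕ)) : Prop :=
  w.length ≤ 2 ^ r ∧ (∀ D ∈ w, D ∈ L ∧ D.length ≤ 2 ^ l) ∧ ∀ i ∈ B, ∃ D ∈ w, i ∈ D

instance (L : List (List ℕ)) (B : List ℕ) (l r : ℕ) (w : List (List ℕ)) :
    Decidable (IsListCover L B l r w) := by unfold IsListCover; infer_instance

theorem primrecPred_isListCover {α : Type*} [Primcodable α] {L w : α → List (List ℕ)}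
    {B : α → List ℕ} {l r : α → ℕ} (hL : Primrec L) (hw : Primrec w) (hB : Primrec B)
    (hl : Primrec l) (hr : Primrec r) :
    PrimrecPred fun a => IsListCover (L a) (B a) (l a) (r a) (w a) := by
  have h2 : ∀ {l : α → ℕ}, Primrec l → Primrec fun a => 2 ^ l a :=
    fun h => Primrec.nat_pow.comp (Primrec.const 2) h
  have h3 : PrimrecPred fun b : α × List ℕ => b.2 ∈ L b.1 ∧ b.2.length ≤ 2 ^ l b.1 :=
    PrimrecPred.and (Primrec.list_mem.comp Primrec.snd (hL.comp Primrec.fst))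
      (Primrec.nat_le.comp (Primrec.list_length.comp Primrec.snd) ((h2 hl).comp Primrec.fst))
  have h4 : PrimrecPred fun b : α × ℕ => ∃ D ∈ w b.1, b.2 ∈ D :=
    PrimrecPred.exists_mem (p := fun (b : α × ℕ) D => b.2 ∈ D) (hw.comp Primrec.fst)
      (Primrec.list_mem.comp (Primrec.snd.comp Primrec.fst) Primrec.snd)
  exact PrimrecPred.and (Primrec.nat_le.comp (Primrec.list_length.comp hw) (h2 hr))
    (PrimrecPred.and (PrimrecPred.forall_mem hw
        (p := fun a D => D ∈ L a ∧ D.length ≤ 2 ^ l a) h3.primrecRel)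
      (PrimrecPred.forall_mem hB (p := fun a i => ∃ D ∈ w a, i ∈ D) h4.primrecRel))

theorem size_lt_pow {p k : ℕ} (h : p + 1 < 2 ^ k) : p.size ≤ k := Nat.size_le.2 (by omega)

/-- Search for a small cover of the coded list `b` by lists of the coded family `y`. -/
def searchCover (a : (ℕ × ℕ) × ℕ × ℕ) : Part (List (List ℕ)) := Nat.rfindOpt fun k =>
  (Encodable.decode (α := List (List ℕ)) k).bind fun w =>
    if IsListCover (familyLists a.2.1) ((Encodable.decode (α := List ℕ) a.2.2).getD [])
      a.1.1 a.1.2 w then some w else none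

theorem partrec_searchCover : Partrec searchCover := by
  have h : PrimrecPred fun b : (((ℕ × ℕ) × ℕ × ℕ) × ℕ) × List (List ℕ) =>
      IsListCover (familyLists b.1.1.2.1) ((Encodable.decode (α := List ℕ) b.1.1.2.2).getD [])
        b.1.1.1.1 b.1.1.1.2 b.2 := by
    have h0 : Primrec fun b : (((ℕ × ℕ) × ℕ × ℕ) × ℕ) × List (List ℕ) => b.1.1 :=
      Primrec.fst.comp Primrec.fst
    have h1 : Primrec fun b : (((ℕ × ℕ) × ℕ × ℕ) × ℕ) × List (List ℕ) => b.1.1.1 :=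
      Primrec.fst.comp h0
    have h2 : Primrec fun b : (((ℕ × ℕ) × ℕ × ℕ) × ℕ) × List (List ℕ) => b.1.1.2 :=
      Primrec.snd.comp h0
    exact primrecPred_isListCover (primrec_familyLists.comp (Primrec.fst.comp h2)) Primrec.snd
      (Primrec.option_getD.comp (Primrec.decode.comp (Primrec.snd.comp h2)) (Primrec.const []))
      (Primrec.fst.comp h1) (Primrec.snd.comp h1)
  have h' : Primrec₂ fun (b : ((ℕ × ℕ) × ℕ × ℕ) × ℕ) (w : List (List ℕ)) =>
      if IsListCover (familyLists b.1.2.1) ((Encodable.decode (α := List ℕ) b.1.2.2).getD [])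
        b.1.1.1 b.1.1.2 w then some w else none :=
    Primrec.ite h (Primrec.option_some.comp Primrec.snd) (Primrec.const none)
  exact Partrec.rfindOpt (Primrec.option_bind (Primrec.decode.comp Primrec.snd) h').to_comp

/-- The member of a cover of the printed set that is described by the parameters `p`, `l`, `r`
(a program of the family, the logarithm of the size of the members and of the cover) and by `q`
(a program of the set, and the index in the cover). -/
def coverMember (U : Str →. Str) (z : List ℕ × ℕ) : Part ℕ :=
  (numMachine U (z.1.getD 0 0)).bind fun y =>
    (numMachine U (z.2 / 2 ^ z.1.getD 2 0)).bind fun b =>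
      (searchCover ((z.1.getD 1 0, z.1.getD 2 0), y, b)).map fun w =>
        Encodable.encode (w.getD (z.2 % 2 ^ z.1.getD 2 0) [])

theorem partrec_coverMember {U : Str →. Str} (hU : Partrec U) : Partrec (coverMember U) := by
  have hu := partrec_numMachine hU
  have hget : ∀ i, Primrec fun z : List ℕ × ℕ => z.1.getD i 0 := fun i =>
    (Primrec.list_getD 0).comp Primrec.fst (Primrec.const i)
  have hpow : Primrec fun z : List ℕ × ℕ => 2 ^ z.1.getD 2 0 :=
    Primrec.nat_pow.comp (Primrec.const 2) (hget 2)
  have h1 : Partrec fun z : List ℕ × ℕ => numMachine U (z.1.getD 0 0) := hu.comp (hget 0).to_comp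
  have h2 : Partrec fun a : (List ℕ × ℕ) × ℕ => numMachine U (a.1.2 / 2 ^ a.1.1.getD 2 0) :=
    hu.comp ((Primrec.nat_div.comp Primrec.snd hpow).comp Primrec.fst).to_comp
  have h3 : Primrec fun a : ((List ℕ × ℕ) × ℕ) × ℕ =>
      ((a.1.1.1.getD 1 0, a.1.1.1.getD 2 0), a.1.2, a.2) := by
    have h0 : Primrec fun a : ((List ℕ × ℕ) × ℕ) × ℕ => a.1.1 := Primrec.fst.comp Primrec.fst
    exact Primrec.pair (Primrec.pair ((hget 1).comp h0) ((hget 2).comp h0))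
      (Primrec.pair (Primrec.snd.comp Primrec.fst) Primrec.snd)
  have h4 : Primrec fun a : (((List ℕ × ℕ) × ℕ) × ℕ) × List (List ℕ) =>
      Encodable.encode (a.2.getD (a.1.1.1.2 % 2 ^ a.1.1.1.1.getD 2 0) []) := by
    have h0 : Primrec fun a : (((List ℕ × ℕ) × ℕ) × ℕ) × List (List ℕ) => a.1.1.1 :=
      Primrec.fst.comp (Primrec.fst.comp Primrec.fst)
    have h5 : Primrec fun z : List ℕ × ℕ => z.2 % 2 ^ z.1.getD 2 0 :=
      Primrec.nat_mod.comp Primrec.snd hpow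
    exact Primrec.encode.comp ((Primrec.list_getD []).comp Primrec.snd (h5.comp h0))
  have h6 : Partrec fun a : ((List ℕ × ℕ) × ℕ) × ℕ =>
      (searchCover ((a.1.1.1.getD 1 0, a.1.1.1.getD 2 0), a.1.2, a.2)).map fun w =>
        Encodable.encode (w.getD (a.1.1.2 % 2 ^ a.1.1.1.getD 2 0) []) :=
    Partrec.map (partrec_searchCover.comp h3.to_comp) h4.to_comp.to₂
  exact h1.bind (Partrec.to₂ (h2.bind h6.to₂))

/-- The cover `ℬ` serves only to make the search halt. The cover actually found depends on `F`, `B`,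
`l`, `r` alone, so `x` enters the description just through an index of `r` bits. -/
theorem exists_mem_cover_complexity_le {U : Str →. Str} (hU : IsReferenceMachine U) :
    ∃ c : ℕ, ∀ (F ℬ : Finset (Finset Str)) (B : Finset Str) (l r : ℕ), ℬ ⊆ F →
      (∀ D ∈ ℬ, D.card ≤ 2 ^ l) → (∀ x ∈ B, ∃ D ∈ ℬ, x ∈ D) → ℬ.card ≤ 2 ^ r → ∀ x ∈ B,
      ∃ D ∈ F, x ∈ D ∧ D.card ≤ 2 ^ l ∧ setComplexity U D ≤
        setComplexity U B + r + 2 * familyComplexity U F + 2 * l.size + 2 * r.size + c := by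
  obtain ⟨c, hc⟩ := complexity_le_of_partrec hU (partrec_coverMember hU.1)
  refine ⟨c + 9, fun F ℬ B l r hℬ hcard hcov hr x hx => ?_⟩
  obtain ⟨p, hp, hpy⟩ := exists_numProgram hU (listCode (F.image setCode))
  obtain ⟨b, hb, hby⟩ := exists_numProgram hU (listCode B)
  have hdom : (searchCover ((l, r), listCode (F.image setCode), listCode B)).Dom := by
    refine Nat.rfindOpt_dom.2 ⟨Encodable.encode (ℬ.toList.map listing), ℬ.toList.map listing, ?_⟩
    rw [Encodable.encodek]
    simp only [Option.bind_some, Option.mem_def, Option.ite_none_right_eq_some, and_true]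
    refine ⟨by simpa using hr, ?_, ?_⟩
    · intro D hD
      obtain ⟨D, hD', rfl⟩ := List.mem_map.1 hD
      have hD := Finset.mem_toList.1 hD'
      exact ⟨listing_mem_familyLists.2 (hℬ hD), by rw [length_listing]; exact hcard D hD⟩
    · intro i hi
      simp only [listCode, Encodable.encodek, Option.getD_some] at hi
      obtain ⟨D, hD, hi'⟩ := hcov _ (mem_listing.1 hi)
      exact ⟨listing D, List.mem_map_of_mem (Finset.mem_toList.2 hD), mem_listing.2 hi'⟩
  obtain ⟨w, hw⟩ := Part.dom_iff_mem.1 hdom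
  have hw' : IsListCover (familyLists (listCode (F.image setCode))) (listing B) l r w := by
    obtain ⟨k, hk⟩ := Nat.rfindOpt_spec hw
    simp only [Option.mem_def, Option.bind_eq_some_iff, Option.ite_none_right_eq_some,
      Option.some.injEq] at hk
    obtain ⟨v, -, hv, rfl⟩ := hk
    simpa [listCode] using hv
  obtain ⟨D', hD', hxD'⟩ := hw'.2.2 _ (strToNat_mem_listing.2 hx)
  obtain ⟨hDL, hDl⟩ := hw'.2.1 D' hD'
  obtain ⟨D, hDF, rfl⟩ := mem_familyLists.1 hDL
  refine ⟨D, hDF, strToNat_mem_listing.1 hxD', by rwa [length_listing] at hDl, ?_⟩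
  obtain ⟨i, hi, hiD⟩ := List.getElem_of_mem hD'
  have hi' : i < 2 ^ r := hi.trans_le hw'.1
  -- The index fills the `r` low digits of a number whose high part is the program of `B`; their
  -- lengths add without any doubling.
  have hdiv : (i + 2 ^ r * b) / 2 ^ r = b := by
    rw [Nat.add_mul_div_left _ _ (by positivity), Nat.div_eq_of_lt hi', zero_add]
  have hmod : (i + 2 ^ r * b) % 2 ^ r = i := by
    rw [Nat.add_mul_mod_self_left, Nat.mod_eq_of_lt hi']
  have hmem : listCode D ∈ coverMember U ([p, l, r], i + 2 ^ r * b) := by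
    refine Part.mem_bind hpy (Part.mem_bind (a := listCode B) ?_ ?_)
    · simpa [hdiv] using hby
    · refine (Part.mem_map_iff _).2 ⟨w, hw, ?_⟩
      simp [hmod, List.getD_eq_getElem?_getD, List.getElem?_eq_getElem hi, hiD, listCode]
  have hmain := hc _ _ _ hmem
  have hsz : (i + 2 ^ r * b).size ≤ r + (setComplexity U B + 1) := by
    refine Nat.size_le.2 ?_
    rw [pow_add]
    rw [← setComplexity_eq] at hb
    calc i + 2 ^ r * b < 2 ^ r * (b + 1) := by rw [mul_add]; omega
      _ ≤ _ := Nat.mul_le_mul_left _ hb.le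
  have hpsz := size_lt_pow hp
  rw [← setComplexity_eq] at hpsz
  simp only [List.map_cons, List.map_nil, List.sum_cons, List.sum_nil] at hmain
  rw [← setComplexity_eq] at hmain
  unfold familyComplexity
  omega

/-! ### The canonical rate-distortion function is close to a shape -/

theorem size_add_le (a b : ℕ) : (a + b).size ≤ a.size + b.size + 1 := by
  rw [Nat.size_le]
  have h1 := Nat.lt_size_self a
  have h2 := Nat.lt_size_self b
  have h3 : 2 ^ a.size ≤ 2 ^ (a.size + b.size) := Nat.pow_le_pow_right (by norm_num) (by omega)
  have h4 : 2 ^ b.size ≤ 2 ^ (a.size + b.size) := Nat.pow_le_pow_right (by norm_num) (by omega)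
  rw [pow_succ]
  omega

theorem size_le_self (n : ℕ) : n.size ≤ n := Nat.size_le.2 n.lt_two_pow_self

theorem logb_le_size (n : ℕ) : Real.logb 2 n ≤ n.size := by
  rcases Nat.eq_zero_or_pos n with rfl | hn
  · simp
  · rw [Real.logb_le_iff_le_rpow (by norm_num) (by exact_mod_cast hn), Real.rpow_natCast]
    exact_mod_cast (Nat.lt_size_self n).le

theorem logb_natCast_nonneg (n : ℕ) : 0 ≤ Real.logb 2 n := by
  rcases Nat.eq_zero_or_pos n with rfl | hn
  · simp
  · exact Real.logb_nonneg (by norm_num) (by exact_mod_cast hn)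

theorem size_le_logb_add_one (n : ℕ) : (n.size : ℝ) ≤ Real.logb 2 n + 1 := by
  rcases Nat.eq_zero_or_pos n with rfl | hn
  · simp
  · have h1 : 0 < n.size := Nat.size_pos.2 hn
    have h2 : 2 ^ (n.size - 1) ≤ n := Nat.lt_size.1 (by omega)
    have h3 : ((n.size - 1 : ℕ) : ℝ) ≤ Real.logb 2 n := by
      rw [Real.le_logb_iff_rpow_le (by norm_num) (by exact_mod_cast hn), Real.rpow_natCast]
      exact_mod_cast h2
    rw [Nat.cast_sub h1] at h3
    push_cast at h3
    linarith

theorem exists_familyComplexity_le {U : Str →. Str} {𝒜 : Set (Finset Str)} (h : SimpleSlices U 𝒜) :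
    ∃ e : ℕ, ∀ n : ℕ, familyComplexity U (slice 𝒜 n) ≤ e * (n.size + 1) := by
  obtain ⟨c, hc⟩ := h
  refine ⟨⌈|c|⌉₊, fun n => ?_⟩
  have h1 := hc n
  have h2 := logb_le_size n
  have h3 := logb_natCast_nonneg n
  have h4 := Nat.le_ceil |c|
  have h5 : c * Real.logb 2 n + c ≤ |c| * (Real.logb 2 n + 1) := by
    rw [← mul_add_one]
    exact mul_le_mul_of_nonneg_right (le_abs_self c) (by linarith)
  have h6 : |c| * (Real.logb 2 n + 1) ≤ ⌈|c|⌉₊ * (n.size + 1) := by gcongr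
  exact_mod_cast h1.trans (h5.trans h6)

/-- From `n ≤ 2 ^ n.size`. The spare factor 2 is spent in `HasCovers.exists_rich`. -/
theorem Polynomial.exists_eval_natCast_le (P : Polynomial ℝ) :
    ∃ e : ℕ, 0 < e ∧ ∀ n : ℕ, 2 * P.eval (n : ℝ) ≤ 2 ^ (e * (n.size + 1)) := by
  set C := ∑ i ∈ Finset.range (P.natDegree + 1), |P.coeff i| with hC
  obtain ⟨k, hk⟩ := pow_unbounded_of_one_lt (2 * C) (by norm_num : (1 : ℝ) < 2)
  refine ⟨P.natDegree + k + 1, by omega, fun n => ?_⟩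
  have hn : (n : ℝ) ≤ 2 ^ n.size := by exact_mod_cast (Nat.lt_size_self n).le
  have h1 : P.eval (n : ℝ) ≤ C * 2 ^ (n.size * P.natDegree) := by
    rw [Polynomial.eval_eq_sum_range, hC, Finset.sum_mul]
    refine Finset.sum_le_sum fun i hi => ?_
    have hi' : i ≤ P.natDegree := by simpa [Nat.lt_succ_iff] using hi
    have h2 : (n : ℝ) ^ i ≤ 2 ^ (n.size * P.natDegree) := by
      calc (n : ℝ) ^ i ≤ (2 ^ n.size) ^ i := by gcongr
        _ = 2 ^ (n.size * i) := by rw [pow_mul]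
        _ ≤ _ := pow_le_pow_right₀ (by norm_num) (Nat.mul_le_mul_left _ hi')
    calc P.coeff i * (n : ℝ) ^ i ≤ |P.coeff i| * (n : ℝ) ^ i := by
          gcongr
          exact le_abs_self _
      _ ≤ _ := by gcongr
  calc 2 * P.eval (n : ℝ) ≤ 2 * C * 2 ^ (n.size * P.natDegree) := by linarith
    _ ≤ 2 ^ k * 2 ^ (n.size * P.natDegree) := by gcongr
    _ = 2 ^ (k + n.size * P.natDegree) := by rw [pow_add]
    _ ≤ _ := pow_le_pow_right₀ (by norm_num) (by nlinarith [Nat.zero_le (n.size * k)])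

/-- Covers inside one slice, with all bounds in natural numbers. -/
theorem exists_slice_cover {𝒜 : Set (Finset Str)} (h2 : EqualLengths 𝒜)
    (h4 : PolynomialCovering 𝒜) : ∃ e : ℕ, 0 < e ∧ ∀ (n c : ℕ) (A : Finset Str), 0 < c →
      A ∈ slice 𝒜 n → c ≤ A.card → ∃ ℬ ⊆ slice 𝒜 n, (∀ B ∈ ℬ, B.card ≤ c) ∧
        (∀ x ∈ A, ∃ B ∈ ℬ, x ∈ B) ∧ 2 * ℬ.card * c ≤ 2 ^ (e * (n.size + 1)) * A.card := by
  obtain ⟨P, hP⟩ := h4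
  obtain ⟨e, he, hPe⟩ := P.exists_eval_natCast_le
  refine ⟨e, he, fun n c A hc hA hcA => ?_⟩
  obtain ⟨ℬ, h1, h3, h5⟩ := hP n c hc A hA hcA
  classical
  -- A member that meets `A` lies in the slice by `EqualLengths`, so the discarded ones cover
  -- nothing.
  refine ⟨ℬ.filter (fun B => B ∈ slice 𝒜 n), fun B hB => (Finset.mem_filter.1 hB).2,
    fun B hB => (h1 B (Finset.mem_filter.1 hB).1).2, fun x hx => ?_, ?_⟩
  · obtain ⟨B, hB, hxB⟩ := h3 x hx
    have hxn : x.length = n := (mem_slice.1 hA).2 x hx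
    exact ⟨B, Finset.mem_filter.2 ⟨hB, hxn ▸ mem_slice_of_mem h2 (h1 B hB).1 hxB⟩, hxB⟩
  · have hc' : (0 : ℝ) < c := by exact_mod_cast hc
    rw [le_div_iff₀ hc'] at h5
    have h6 : ((ℬ.filter (fun B => B ∈ slice 𝒜 n)).card : ℝ) ≤ ℬ.card := by
      exact_mod_cast Finset.card_filter_le _ _
    have h7 : 2 * P.eval (n : ℝ) * A.card ≤ 2 ^ (e * (n.size + 1)) * A.card := by
      gcongr
      exact hPe n
    have h8 : 2 * ((ℬ.filter (fun B => B ∈ slice 𝒜 n)).card : ℝ) * c ≤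
        2 ^ (e * (n.size + 1)) * A.card := by nlinarith
    exact_mod_cast h8

theorem cube_mem_slice {𝒜 : Set (Finset Str)} (h1 : ContainsCubes 𝒜) (n : ℕ) :
    cube n ∈ slice 𝒜 n := mem_slice.2 ⟨h1 n, fun _ hx => mem_cube.1 hx⟩

theorem canonicalRD_le {U : Str →. Str} {𝒜 : Set (Finset Str)} {x : Str} {B : Finset Str}
    {l : ℕ} (hB : B ∈ 𝒜) (hx : x ∈ B) (hl : B.card ≤ 2 ^ l) :
    canonicalRD U 𝒜 x l ≤ setComplexity U B := Nat.sInf_le ⟨B, hB, hx, hl, rfl⟩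

theorem exists_canonicalRD_eq (U : Str →. Str) {𝒜 : Set (Finset Str)} (h1 : ContainsCubes 𝒜)
    (h2 : EqualLengths 𝒜) (h4 : PolynomialCovering 𝒜) {x : Str} {l : ℕ} (hl : l ≤ x.length) :
    ∃ B ∈ slice 𝒜 x.length, x ∈ B ∧ B.card ≤ 2 ^ l ∧
      setComplexity U B = canonicalRD U 𝒜 x l := by
  obtain ⟨e, -, he⟩ := exists_slice_cover h2 h4
  -- A cover of the cube supplies an admissible set, so the infimum is attained and is not the
  -- default value of `sInf ∅`.
  obtain ⟨ℬ, hℬ, hc, hcov, -⟩ := he x.length (2 ^ l) (cube x.length) (by positivity)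
    (cube_mem_slice h1 _) (by rw [card_cube]; exact Nat.pow_le_pow_right (by norm_num) hl)
  obtain ⟨D, hD, hxD⟩ := hcov x (mem_cube.2 rfl)
  obtain ⟨B, hB, hxB, hBl, hBC⟩ := Nat.sInf_mem
    (s := {k | ∃ B ∈ 𝒜, x ∈ B ∧ B.card ≤ 2 ^ l ∧ setComplexity U B = k})
    ⟨_, D, (mem_slice.1 (hℬ hD)).1, hxD, hc D hD, rfl⟩
  exact ⟨B, mem_slice_of_mem h2 hB hxB, hxB, hBl, hBC⟩

theorem canonicalRD_anti (U : Str →. Str) {𝒜 : Set (Finset Str)} (h1 : ContainsCubes 𝒜)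
    (h2 : EqualLengths 𝒜) (h4 : PolynomialCovering 𝒜) {x : Str} {l m : ℕ} (hlm : l ≤ m)
    (hm : m ≤ x.length) : canonicalRD U 𝒜 x m ≤ canonicalRD U 𝒜 x l := by
  obtain ⟨B, hB, hx, hl, hC⟩ := exists_canonicalRD_eq U h1 h2 h4 (hlm.trans hm)
  rw [← hC]
  exact canonicalRD_le (mem_slice.1 hB).1 hx
    (hl.trans (Nat.pow_le_pow_right (by norm_num) hlm))

theorem exists_canonicalRD_le_add {U : Str →. Str} (hU : IsReferenceMachine U)
    {𝒜 : Set (Finset Str)} (h1 : ContainsCubes 𝒜) (h2 : EqualLengths 𝒜)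
    (h3 : SimpleSlices U 𝒜) (h4 : PolynomialCovering 𝒜) :
    ∃ K : ℕ, ∀ x : Str, canonicalRD U 𝒜 x x.length ≤ K * (x.length.size + 1) ∧
      ∀ l m : ℕ, l ≤ m → m ≤ x.length →
        canonicalRD U 𝒜 x l ≤ canonicalRD U 𝒜 x m + (m - l) + K * (x.length.size + 1) := by
  obtain ⟨c, hc⟩ := setComplexity_cube_le hU
  obtain ⟨c', hc'⟩ := exists_mem_cover_complexity_le hU
  obtain ⟨e, -, he⟩ := exists_slice_cover h2 h4
  obtain ⟨e', he'⟩ := exists_familyComplexity_le h3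
  refine ⟨1 + c + c' + 3 * e + 2 * e' + 6, fun x => ⟨?_, fun l m hlm hm => ?_⟩⟩
  · have := canonicalRD_le (U := U) (h1 x.length) (mem_cube.2 (rfl : x.length = x.length))
      (card_cube _).le
    have := hc x.length
    nlinarith [Nat.zero_le (c * x.length.size), Nat.zero_le (c' * x.length.size),
      Nat.zero_le (e * x.length.size), Nat.zero_le (e' * x.length.size)]
  · obtain ⟨B, hB, hx, hBm, hC⟩ := exists_canonicalRD_eq U h1 h2 h4 hm
    set n := x.length with hn
    -- The covering property speaks only of sets with at least `2 ^ l` elements; a smaller set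
    -- serves as its own cover.
    rcases le_or_gt B.card (2 ^ l) with hl | hl
    · have := canonicalRD_le (U := U) (mem_slice.1 hB).1 hx hl
      omega
    · obtain ⟨ℬ, hℬ, hcard, hcov, hbd⟩ := he n (2 ^ l) B (by positivity) hB hl.le
      have hr : ℬ.card ≤ 2 ^ (e * (n.size + 1) + (m - l)) := by
        refine Nat.le_of_mul_le_mul_right (c := 2 ^ l) ?_ (by positivity)
        rw [← pow_add, add_assoc, Nat.sub_add_cancel hlm, pow_add]
        have := Nat.mul_le_mul_left (2 ^ (e * (n.size + 1))) hBm
        linarith [Nat.zero_le (ℬ.card * 2 ^ l)]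
      obtain ⟨D, hD, hxD, hDl, hDC⟩ := hc' _ ℬ B l _ hℬ hcard hcov hr x hx
      have h5 := canonicalRD_le (U := U) (mem_slice.1 hD).1 hxD hDl
      have h6 := he' n
      have h7 := size_add_le (e * (n.size + 1)) (m - l)
      have h8 := size_le_self (e * (n.size + 1))
      have h9 : (m - l).size ≤ n.size := Nat.size_le_size (by omega)
      have h10 : l.size ≤ n.size := Nat.size_le_size (by omega)
      rw [hC] at hDC
      nlinarith [Nat.zero_le (c * n.size), Nat.zero_le (c' * n.size)]

/-- Every function that is nonincreasing, decreases with slope at most one and nearly vanishes at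
`n`, up to an error `K`, is close to a shape. -/
theorem exists_shape_close {n K : ℕ} (f : ℕ → ℕ) (hanti : ∀ l m, l ≤ m → m ≤ n → f m ≤ f l)
    (hn : f n ≤ K) (hadd : ∀ l m, l ≤ m → m ≤ n → f l ≤ f m + (m - l) + K) :
    ∃ g ∈ shapes n, ∀ l : Fin (n + 1), f l ≤ g l + 2 * K ∧ g l ≤ f l + K := by
  -- `G k` belongs to the argument `n - k`: read downwards from `n`, it is the largest function
  -- below `f` that starts at 0 and grows by at most 1 per step.
  let G : ℕ → ℕ := fun k => Nat.rec 0 (fun k G => min (f (n - (k + 1))) (G + 1)) k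
  have hG0 : G 0 = 0 := rfl
  have hGs : ∀ k, G (k + 1) = min (f (n - (k + 1))) (G k + 1) := fun k => rfl
  have hGf : ∀ k, k ≤ n → G k ≤ f (n - k) := by
    intro k hk
    rcases k with _ | k
    · simp [hG0]
    · rw [hGs]; exact min_le_left _ _
  -- `G` was last cut off by `f` at some `j` and has grown with slope one since; if it was never cut
  -- off, `j = 0` works because `f n ≤ K`.
  have hex : ∀ k, k ≤ n → ∃ j ≤ k, f (n - j) + (k - j) ≤ G k + K := by
    intro k hk
    induction k with
    | zero => exact ⟨0, le_rfl, by simpa [hG0] using hn⟩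
    | succ k ih =>
      rw [hGs]
      rcases le_total (f (n - (k + 1))) (G k + 1) with h | h
      · exact ⟨k + 1, le_rfl, by rw [min_eq_left h]; omega⟩
      · obtain ⟨j, hj, hj'⟩ := ih (by omega)
        exact ⟨j, by omega, by rw [min_eq_right h]; omega⟩
  refine ⟨fun l => G (n - l), ⟨by simp [hG0], fun l => ?_⟩, fun l => ⟨?_, ?_⟩⟩
  · have hl := l.2
    simp only [Fin.val_castSucc, Fin.val_succ]
    have e : n - (l : ℕ) = (n - (l + 1)) + 1 := by omega
    rw [e, hGs]
    have h1 := hGf (n - (l + 1)) (by omega)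
    have h2 := hanti (n - (n - (l + 1) + 1)) (n - (n - (l + 1))) (by omega) (by omega)
    omega
  · have hl := l.2
    obtain ⟨j, hj, hj'⟩ := hex (n - l) (by omega)
    have := hadd l (n - j) (by omega) (by omega)
    simp only
    omega
  · have hl := l.2
    have := hGf (n - l) (by omega)
    rw [show n - (n - (l : ℕ)) = l by omega] at this
    exact this.trans (by omega)

theorem exists_shape_of_string {U : Str →. Str} (hU : IsReferenceMachine U)
    {𝒜 : Set (Finset Str)} (h1 : ContainsCubes 𝒜) (h2 : EqualLengths 𝒜)
    (h3 : SimpleSlices U 𝒜) (h4 : PolynomialCovering 𝒜) :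
    ∃ c : ℝ, ∀ n : ℕ, ∀ x : Str, x.length = n →
      ∃ g ∈ shapes n, ∀ l : Fin (n + 1),
        |(canonicalRD U 𝒜 x l : ℝ) - (g l : ℝ)| ≤ c * Real.logb 2 n + c := by
  obtain ⟨K, hK⟩ := exists_canonicalRD_le_add hU h1 h2 h3 h4
  refine ⟨4 * K, ?_⟩
  rintro n x rfl
  obtain ⟨g, hg, hg'⟩ := exists_shape_close (n := x.length) (canonicalRD U 𝒜 x)
    (fun l m hlm hm => canonicalRD_anti U h1 h2 h4 hlm hm) (hK x).1 (hK x).2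
  refine ⟨g, hg, fun l => ?_⟩
  have h5 : (canonicalRD U 𝒜 x l : ℝ) ≤ g l + 2 * (K * (x.length.size + 1)) := by
    exact_mod_cast (hg' l).1
  have h6 : (g l : ℝ) ≤ canonicalRD U 𝒜 x l + K * (x.length.size + 1) := by
    exact_mod_cast (hg' l).2
  have h7 := mul_le_mul_of_nonneg_left (size_le_logb_add_one x.length) (Nat.cast_nonneg (α := ℝ) K)
  have h8 := mul_nonneg (Nat.cast_nonneg (α := ℝ) K) (logb_natCast_nonneg x.length)
  have h9 : (0 : ℝ) ≤ K * x.length.size := by positivity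
  have h10 : (0 : ℝ) ≤ K := by positivity
  rw [abs_le]
  constructor <;> nlinarith

/-! ### A chain of sets chosen along the enumeration of simple sets

A *level* is a triple `(l, k, t)`: sets with at most `2 ^ l` elements and programs shorter than
`k` are removed, and at least `2 ^ t` elements have to survive. -/

section Chain

variable (e : Nat.Partrec.Code) (L : List (List ℕ)) (R : List (ℕ × ℕ × ℕ))

/-- The list printed by the program `p` within `s` steps, if it is in `L` and has at most `2 ^ l`
elements. -/
def printedWithin (l s p : ℕ) : Option (List ℕ) :=
  (e.evaln s p).bind fun y => (Encodable.decode (α := List ℕ) y).bind fun z =>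
    if z ∈ L ∧ z.length ≤ 2 ^ l then some z else none

/-- All lists printed within `s` steps by the short programs of the levels `R`. -/
def removedLists (s : ℕ) : List (List ℕ) :=
  -- The numbers below `2 ^ k - 1` are those of the strings shorter than `k`; there are none for `k
  -- = 0`.
  R.flatMap fun r => (List.range (2 ^ r.2.1 - 1)).filterMap (printedWithin e L r.1 s)

/-- The elements of all sets removed within `s` steps. -/
def removed (s : ℕ) : List ℕ := (removedLists e L R s).flatten

/-- The clock of level `j`: every removal at levels up to `j` is a full tick, and removals at
finer levels count by their cardinality in units of `2 ^ t`. -/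
def tick (j s : ℕ) : ℕ :=
  (2 ^ (R.getD j 0).2.2 * (removedLists e L (R.take (j + 1)) s).length +
    (removed e L (R.drop (j + 1)) s).length) / 2 ^ (R.getD j 0).2.2

/-- The sum of the clocks of the levels up to `j`. -/
def clock (j s : ℕ) : ℕ := ((List.range (j + 1)).map fun i => tick e L R i s).sum

/-- The first stage at which the clock of level `j` shows the same as at stage `s`. -/
def lastChange (j s : ℕ) : ℕ :=
  (List.range (s + 1)).findIdx fun s' => decide (clock e L R j s' = clock e L R j s)

/-- The first member of `L` of the size of level `j` that contains many surviving elements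
of `X`. -/
def richMember (X : List ℕ) (j s : ℕ) : List ℕ :=
  (L.filter fun A => decide (A.length ≤ 2 ^ (R.getD j 0).1 ∧ 2 ^ ((R.getD j 0).2.2 + 1) ≤
    (X.filter fun x => decide (x ∈ A ∧ x ∉ removed e L R s)).length)).head?.getD []

/-- The intersection of the members chosen at the levels below `j`. -/
def chain (n s : ℕ) : ℕ → List ℕ
  | 0 => cubeList n
  | j + 1 => (chain n s j).filter fun x =>
      decide (x ∈ richMember e L R (chain n s j) j (lastChange e L R j s))

/-- The member chosen at level `j`. -/
def chainMember (n s j : ℕ) : List ℕ :=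
  richMember e L R (chain e L R n s j) j (lastChange e L R j s)

variable {α : Type*} [Primcodable α] {L : α → List (List ℕ)} {R : α → List (ℕ × ℕ × ℕ)}
  {s j n : α → ℕ} {X : α → List ℕ}

theorem primrec_two_pow {k : α → ℕ} (hk : Primrec k) : Primrec fun a => 2 ^ k a :=
  Primrec.nat_pow.comp (Primrec.const 2) hk

theorem primrec_printedWithin {l p : α → ℕ} (hL : Primrec L) (hl : Primrec l) (hs : Primrec s)
    (hp : Primrec p) : Primrec fun a => printedWithin e (L a) (l a) (s a) (p a) := by
  have h1 : PrimrecPred fun b : (α × ℕ) × List ℕ =>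
      b.2 ∈ L b.1.1 ∧ b.2.length ≤ 2 ^ l b.1.1 :=
    PrimrecPred.and (Primrec.list_mem.comp Primrec.snd (hL.comp (Primrec.fst.comp Primrec.fst)))
      (Primrec.nat_le.comp (Primrec.list_length.comp Primrec.snd)
        ((primrec_two_pow hl).comp (Primrec.fst.comp Primrec.fst)))
  have h2 : Primrec₂ fun (b : α × ℕ) (z : List ℕ) =>
      if z ∈ L b.1 ∧ z.length ≤ 2 ^ l b.1 then some z else none :=
    Primrec.ite h1 (Primrec.option_some.comp Primrec.snd) (Primrec.const none)
  have h3 : Primrec₂ fun (a : α) (y : ℕ) => (Encodable.decode (α := List ℕ) y).bind fun z =>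
      if z ∈ L a ∧ z.length ≤ 2 ^ l a then some z else none :=
    Primrec.option_bind (Primrec.decode.comp Primrec.snd) h2
  exact Primrec.option_bind (Nat.Partrec.Code.primrec_evaln.comp
    ((hs.pair (Primrec.const e)).pair hp)) h3

theorem primrec_removedLists (hL : Primrec L) (hR : Primrec R) (hs : Primrec s) :
    Primrec fun a => removedLists e (L a) (R a) (s a) := by
  have h1 : Primrec₂ fun (b : α × ℕ × ℕ × ℕ) (p : ℕ) =>
      printedWithin e (L b.1) b.2.1 (s b.1) p :=
    primrec_printedWithin e (hL.comp (Primrec.fst.comp Primrec.fst))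
      (Primrec.fst.comp (Primrec.snd.comp Primrec.fst))
      (hs.comp (Primrec.fst.comp Primrec.fst)) Primrec.snd
  have h2 : Primrec₂ fun (a : α) (r : ℕ × ℕ × ℕ) =>
      (List.range (2 ^ r.2.1 - 1)).filterMap (printedWithin e (L a) r.1 (s a)) :=
    Primrec.listFilterMap (Primrec.list_range.comp (Primrec.pred.comp (primrec_two_pow
      (Primrec.fst.comp (Primrec.snd.comp Primrec.snd))))) h1
  exact Primrec.list_flatMap hR h2

theorem primrec_removed (hL : Primrec L) (hR : Primrec R) (hs : Primrec s) :
    Primrec fun a => removed e (L a) (R a) (s a) :=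
  Primrec.list_flatten.comp (primrec_removedLists e hL hR hs)

theorem primrec_tick (hL : Primrec L) (hR : Primrec R) (hj : Primrec j) (hs : Primrec s) :
    Primrec fun a => tick e (L a) (R a) (j a) (s a) := by
  have h1 : Primrec fun a => 2 ^ ((R a).getD (j a) 0).2.2 :=
    primrec_two_pow (Primrec.snd.comp (Primrec.snd.comp ((Primrec.list_getD 0).comp hR hj)))
  have h2 := Primrec.succ.comp hj
  exact Primrec.nat_div.comp (Primrec.nat_add.comp (Primrec.nat_mul.comp h1
    (Primrec.list_length.comp (primrec_removedLists e hL (Primrec.list_take.comp h2 hR) hs)))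
    (Primrec.list_length.comp (primrec_removed e hL (Primrec.list_drop.comp h2 hR) hs))) h1

theorem primrec_list_sum : Primrec (List.sum : List ℕ → ℕ) :=
  Primrec.list_foldr Primrec.id (Primrec.const 0)
    (Primrec.nat_add.comp (Primrec.fst.comp Primrec.snd) (Primrec.snd.comp Primrec.snd)).to₂

theorem primrec_clock (hL : Primrec L) (hR : Primrec R) (hj : Primrec j) (hs : Primrec s) :
    Primrec fun a => clock e (L a) (R a) (j a) (s a) :=
  primrec_list_sum.comp (Primrec.list_map (Primrec.list_range.comp (Primrec.succ.comp hj))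
    (primrec_tick e (hL.comp Primrec.fst) (hR.comp Primrec.fst) Primrec.snd
      (hs.comp Primrec.fst)).to₂)

theorem primrec_lastChange (hL : Primrec L) (hR : Primrec R) (hj : Primrec j) (hs : Primrec s) :
    Primrec fun a => lastChange e (L a) (R a) (j a) (s a) := by
  have h1 : PrimrecPred fun b : α × ℕ =>
      clock e (L b.1) (R b.1) (j b.1) b.2 = clock e (L b.1) (R b.1) (j b.1) (s b.1) :=
    Primrec.eq.comp (primrec_clock e (hL.comp Primrec.fst) (hR.comp Primrec.fst)
      (hj.comp Primrec.fst) Primrec.snd) ((primrec_clock e hL hR hj hs).comp Primrec.fst)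
  exact Primrec.list_findIdx (Primrec.list_range.comp (Primrec.succ.comp hs)) h1.decide.to₂

theorem primrec_richMember (hL : Primrec L) (hR : Primrec R) (hX : Primrec X) (hj : Primrec j)
    (hs : Primrec s) : Primrec fun a => richMember e (L a) (R a) (X a) (j a) (s a) := by
  have h0 : Primrec fun a => (R a).getD (j a) 0 := (Primrec.list_getD 0).comp hR hj
  have h1 : PrimrecPred fun b : (α × List ℕ) × ℕ =>
      b.2 ∈ b.1.2 ∧ b.2 ∉ removed e (L b.1.1) (R b.1.1) (s b.1.1) :=
    PrimrecPred.and (Primrec.list_mem.comp Primrec.snd (Primrec.snd.comp Primrec.fst))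
      (PrimrecPred.not (Primrec.list_mem.comp Primrec.snd
        ((primrec_removed e hL hR hs).comp (Primrec.fst.comp Primrec.fst))))
  have h2 : Primrec fun b : α × List ℕ => (X b.1).filter fun x =>
      decide (x ∈ b.2 ∧ x ∉ removed e (L b.1) (R b.1) (s b.1)) :=
    Primrec.list_filter_rel (hX.comp Primrec.fst) h1.primrecRel
  have h3 : PrimrecPred fun b : α × List ℕ => b.2.length ≤ 2 ^ ((R b.1).getD (j b.1) 0).1 ∧
      2 ^ (((R b.1).getD (j b.1) 0).2.2 + 1) ≤ ((X b.1).filter fun x =>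
        decide (x ∈ b.2 ∧ x ∉ removed e (L b.1) (R b.1) (s b.1))).length :=
    PrimrecPred.and (Primrec.nat_le.comp (Primrec.list_length.comp Primrec.snd)
      (primrec_two_pow (Primrec.fst.comp (h0.comp Primrec.fst))))
      (Primrec.nat_le.comp (primrec_two_pow (Primrec.succ.comp
        (Primrec.snd.comp (Primrec.snd.comp (h0.comp Primrec.fst)))))
        (Primrec.list_length.comp h2))
  have h4 := Primrec.list_filter_rel hL (p := fun a A => A.length ≤ 2 ^ ((R a).getD (j a) 0).1 ∧
    2 ^ (((R a).getD (j a) 0).2.2 + 1) ≤ ((X a).filter fun x =>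
      decide (x ∈ A ∧ x ∉ removed e (L a) (R a) (s a))).length) h3.primrecRel
  exact Primrec.option_getD.comp (Primrec.list_head?.comp h4) (Primrec.const [])

theorem primrec_chain (hL : Primrec L) (hR : Primrec R) (hn : Primrec n) (hs : Primrec s)
    (hj : Primrec j) : Primrec fun a => chain e (L a) (R a) (n a) (s a) (j a) := by
  have h1 : Primrec fun b : α × ℕ × List ℕ => richMember e (L b.1) (R b.1) b.2.2 b.2.1
      (lastChange e (L b.1) (R b.1) b.2.1 (s b.1)) :=
    primrec_richMember e (hL.comp Primrec.fst) (hR.comp Primrec.fst)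
      (Primrec.snd.comp Primrec.snd) (Primrec.fst.comp Primrec.snd)
      (primrec_lastChange e (hL.comp Primrec.fst) (hR.comp Primrec.fst)
        (Primrec.fst.comp Primrec.snd) (hs.comp Primrec.fst))
  have h2 : Primrec₂ fun (a : α) (b : ℕ × List ℕ) => b.2.filter fun x =>
      decide (x ∈ richMember e (L a) (R a) b.2 b.1 (lastChange e (L a) (R a) b.1 (s a))) := by
    refine Primrec.list_filter_rel (α := α × ℕ × List ℕ) (Primrec.snd.comp Primrec.snd)
      (p := fun b x => x ∈ richMember e (L b.1) (R b.1) b.2.2 b.2.1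
        (lastChange e (L b.1) (R b.1) b.2.1 (s b.1))) ?_
    exact Primrec.list_mem.comp Primrec.snd (h1.comp Primrec.fst)
  refine (Primrec.nat_rec' hj (primrec_cubeList.comp hn) h2).of_eq fun a => ?_
  induction j a with
  | zero => rfl
  | succ k ih => simp only [chain, ← ih]

theorem primrec_chainMember (hL : Primrec L) (hR : Primrec R) (hn : Primrec n) (hs : Primrec s)
    (hj : Primrec j) : Primrec fun a => chainMember e (L a) (R a) (n a) (s a) (j a) :=
  primrec_richMember e hL hR (primrec_chain e hL hR hn hs hj) hj
    (primrec_lastChange e hL hR hj hs)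

end Chain

/-- The chosen set of level `i`, found from a program of the family, from `n`, `i`, from the
levels, and from the final value `q` of the clock of level `i`. -/
def clockedMember (U : Str →. Str) (e : Nat.Partrec.Code) (z : List ℕ × ℕ) : Part ℕ :=
  (numMachine U (z.1.getD 0 0)).bind fun y =>
    (Nat.rfind fun s => Part.some (decide (z.2 ≤ clock e (familyLists y)
      ((z.1.drop 3).map (Denumerable.ofNat (ℕ × ℕ × ℕ))) (z.1.getD 2 0) s))).map fun s =>
        Encodable.encode (chainMember e (familyLists y)
          ((z.1.drop 3).map (Denumerable.ofNat (ℕ × ℕ × ℕ))) (z.1.getD 1 0) s (z.1.getD 2 0))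

theorem partrec_clockedMember {U : Str →. Str} (hU : Partrec U) (e : Nat.Partrec.Code) :
    Partrec (clockedMember U e) := by
  have hget : ∀ i, Primrec fun z : List ℕ × ℕ => z.1.getD i 0 := fun i =>
    (Primrec.list_getD 0).comp Primrec.fst (Primrec.const i)
  have hR : Primrec fun z : List ℕ × ℕ => (z.1.drop 3).map (Denumerable.ofNat (ℕ × ℕ × ℕ)) :=
    Primrec.list_map (Primrec.list_drop.comp (Primrec.const 3) Primrec.fst)
      ((Primrec.ofNat _).comp Primrec.snd).to₂
  have h0 : Primrec fun a : ((List ℕ × ℕ) × ℕ) × ℕ => a.1.1 := Primrec.fst.comp Primrec.fst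
  have hL : Primrec fun a : ((List ℕ × ℕ) × ℕ) × ℕ => familyLists a.1.2 :=
    primrec_familyLists.comp (Primrec.snd.comp Primrec.fst)
  have h1 : PrimrecPred fun a : ((List ℕ × ℕ) × ℕ) × ℕ => a.1.1.2 ≤ clock e (familyLists a.1.2)
      ((a.1.1.1.drop 3).map (Denumerable.ofNat (ℕ × ℕ × ℕ))) (a.1.1.1.getD 2 0) a.2 :=
    Primrec.nat_le.comp (Primrec.snd.comp h0)
      (primrec_clock e hL (hR.comp h0) ((hget 2).comp h0) Primrec.snd)
  have h2 : Partrec₂ fun (a : (List ℕ × ℕ) × ℕ) (s : ℕ) => Part.some (decide (a.1.2 ≤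
      clock e (familyLists a.2)
        ((a.1.1.drop 3).map (Denumerable.ofNat (ℕ × ℕ × ℕ))) (a.1.1.getD 2 0) s)) :=
    h1.decide.to_comp.partrec
  have h3 : Primrec fun a : ((List ℕ × ℕ) × ℕ) × ℕ => Encodable.encode (chainMember e
      (familyLists a.1.2) ((a.1.1.1.drop 3).map (Denumerable.ofNat (ℕ × ℕ × ℕ)))
        (a.1.1.1.getD 1 0) a.2 (a.1.1.1.getD 2 0)) :=
    Primrec.encode.comp (primrec_chainMember e hL (hR.comp h0) ((hget 1).comp h0) Primrec.snd
      ((hget 2).comp h0))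
  exact Partrec.bind ((partrec_numMachine hU).comp (hget 0).to_comp)
    (Partrec.map (Partrec.rfind h2) h3.to_comp.to₂).to₂

/-! ### Stability of the chosen members while the clocks stand still -/

section ChainCorrectness

variable {e : Nat.Partrec.Code} {L : List (List ℕ)} {R : List (ℕ × ℕ × ℕ)}

theorem printedWithin_mono {l s s' p : ℕ} (h : s ≤ s') {z : List ℕ}
    (hz : printedWithin e L l s p = some z) : printedWithin e L l s' p = some z := by
  simp only [printedWithin, Option.bind_eq_some_iff] at hz ⊢
  obtain ⟨y, hy, hz⟩ := hz
  exact ⟨y, Nat.Partrec.Code.evaln_mono h hy, hz⟩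

theorem printedWithin_spec {l s p : ℕ} {z : List ℕ} (hz : printedWithin e L l s p = some z) :
    z ∈ L ∧ z.length ≤ 2 ^ l := by
  simp only [printedWithin, Option.bind_eq_some_iff, Option.ite_none_right_eq_some] at hz
  obtain ⟨y, -, w, -, hw, h⟩ := hz
  cases h
  exact hw

theorem List.filterMap_sublist_filterMap {α β : Type*} {f g : α → Option β}
    (h : ∀ a b, f a = some b → g a = some b) (l : List α) :
    (l.filterMap f).Sublist (l.filterMap g) := by
  induction l with
  | nil => simp
  | cons a l ih =>
    rw [List.filterMap_cons, List.filterMap_cons]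
    cases hf : f a with
    | none =>
      cases hg : g a with
      | none => exact ih
      | some b => exact ih.cons b
    | some b => rw [h a b hf]; exact ih.cons_cons b

theorem removedLists_sublist {s s' : ℕ} (h : s ≤ s') :
    (removedLists e L R s).Sublist (removedLists e L R s') := by
  unfold removedLists
  induction R with
  | nil => simp
  | cons r R ih =>
    simp only [List.flatMap_cons]
    exact (List.filterMap_sublist_filterMap (fun p z hz => printedWithin_mono h hz) _).append ih

theorem removed_sublist {s s' : ℕ} (h : s ≤ s') :
    (removed e L R s).Sublist (removed e L R s') :=
  (removedLists_sublist h).flatten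

theorem tick_mono (j : ℕ) : Monotone (tick e L R j) := fun _ _ h =>
  Nat.div_le_div_right (add_le_add (Nat.mul_le_mul_left _ (removedLists_sublist h).length_le)
    (removed_sublist h).length_le)

theorem clock_succ (j s : ℕ) : clock e L R (j + 1) s = clock e L R j s + tick e L R (j + 1) s := by
  rw [clock, List.range_succ, List.map_append, List.sum_append]
  simp [clock]

theorem clock_zero (s : ℕ) : clock e L R 0 s = tick e L R 0 s := by simp [clock]

theorem clock_mono (j : ℕ) : Monotone (clock e L R j) := by
  induction j with
  | zero => exact fun s s' h => by rw [clock_zero, clock_zero]; exact tick_mono 0 h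
  | succ j ih =>
    intro s s' h
    rw [clock_succ, clock_succ]
    exact add_le_add (ih h) (tick_mono _ h)

theorem tick_eq_of_clock_eq {j s s' : ℕ} (h : s ≤ s')
    (hc : clock e L R j s = clock e L R j s') : tick e L R j s = tick e L R j s' := by
  cases j with
  | zero => rwa [clock_zero, clock_zero] at hc
  | succ j =>
    rw [clock_succ, clock_succ] at hc
    have h1 := clock_mono (e := e) (L := L) (R := R) j h
    have h2 := tick_mono (e := e) (L := L) (R := R) (j + 1) h
    omega

/-- A sum of monotone ticks stands still only if every summand does. This is why a clock accumulates
the ticks of all earlier levels: its reading then fixes the whole chain below it. -/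
theorem clock_eq_of_le {i j s s' : ℕ} (hij : i ≤ j) (h : s ≤ s')
    (hc : clock e L R j s = clock e L R j s') : clock e L R i s = clock e L R i s' := by
  induction j, hij using Nat.le_induction with
  | base => exact hc
  | succ j _ ih =>
    refine ih ?_
    rw [clock_succ, clock_succ] at hc
    have h1 := clock_mono (e := e) (L := L) (R := R) j h
    have h2 := tick_mono (e := e) (L := L) (R := R) (j + 1) h
    omega

theorem lastChange_eq_find (j s : ℕ) : lastChange e L R j s =
    Nat.find (p := fun s' => clock e L R j s' = clock e L R j s) ⟨s, rfl⟩ := by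
  have hle : Nat.find (p := fun s' => clock e L R j s' = clock e L R j s) ⟨s, rfl⟩ ≤ s :=
    Nat.find_min' _ rfl
  rw [lastChange, List.findIdx_eq (by simpa [Nat.lt_succ_iff] using hle)]
  refine ⟨?_, fun i hi => ?_⟩
  · simpa using Nat.find_spec (p := fun s' => clock e L R j s' = clock e L R j s) ⟨s, rfl⟩
  · simpa using Nat.find_min _ hi

theorem lastChange_le (j s : ℕ) : lastChange e L R j s ≤ s := by
  rw [lastChange_eq_find]
  exact Nat.find_min' _ rfl

theorem clock_lastChange (j s : ℕ) :
    clock e L R j (lastChange e L R j s) = clock e L R j s := by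
  rw [lastChange_eq_find]
  exact Nat.find_spec (p := fun s' => clock e L R j s' = clock e L R j s) ⟨s, rfl⟩

theorem lastChange_congr {j s s' : ℕ} (h : clock e L R j s = clock e L R j s') :
    lastChange e L R j s = lastChange e L R j s' := by
  simp only [lastChange_eq_find, h]

theorem chain_congr {n i s s' : ℕ} (h : s ≤ s') (hc : clock e L R i s = clock e L R i s') :
    ∀ j ≤ i, chain e L R n s j = chain e L R n s' j := by
  intro j hj
  induction j with
  | zero => rfl
  | succ j ih =>
    simp only [chain]
    rw [ih (by omega), lastChange_congr (clock_eq_of_le (by omega) h hc)]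

theorem chainMember_congr {n i s s' : ℕ} (h : s ≤ s')
    (hc : clock e L R i s = clock e L R i s') :
    chainMember e L R n s i = chainMember e L R n s' i := by
  rw [chainMember, chainMember, chain_congr h hc i le_rfl, lastChange_congr hc]

theorem List.Sublist.card_toFinset_sdiff_le {a b : List ℕ} (h : a.Sublist b) :
    (b.toFinset \ a.toFinset).card + a.length ≤ b.length := by
  obtain ⟨l, hl⟩ := h.exists_perm_append
  have h1 : b.toFinset \ a.toFinset ⊆ l.toFinset := by
    intro x
    simp only [Finset.mem_sdiff, List.mem_toFinset, hl.mem_iff, List.mem_append]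
    tauto
  have h2 := (Finset.card_le_card h1).trans (List.toFinset_card_le l)
  have h3 := hl.length_eq
  rw [List.length_append] at h3
  omega

theorem removed_append (R R' : List (ℕ × ℕ × ℕ)) (s : ℕ) :
    removed e L (R ++ R') s = removed e L R s ++ removed e L R' s := by
  simp [removed, removedLists]

/-- Between two stages with the same reading of a clock few elements are removed. -/
theorem card_removed_sdiff_lt {j s s' : ℕ} (h : s ≤ s')
    (ht : tick e L R j s = tick e L R j s') :
    ((removed e L R s').toFinset \ (removed e L R s).toFinset).card <
      2 ^ (R.getD j 0).2.2 := by
  set t := 2 ^ (R.getD j 0).2.2 with ht'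
  have htpos : 0 < t := by positivity
  have h1 := removedLists_sublist (e := e) (L := L) (R := R.take (j + 1)) h
  have h2 := removed_sublist (e := e) (L := L) (R := R.drop (j + 1)) h
  have h3 := h1.length_le
  have h4 := h2.length_le
  have h5 : t * (removedLists e L (R.take (j + 1)) s').length +
      (removed e L (R.drop (j + 1)) s').length <
      t * (removedLists e L (R.take (j + 1)) s).length +
      (removed e L (R.drop (j + 1)) s).length + t := by
    simp only [tick, ← ht'] at ht
    have h6 := Nat.lt_div_mul_add htpos (a := t * (removedLists e L (R.take (j + 1)) s').length +
      (removed e L (R.drop (j + 1)) s').length)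
    have h7 := Nat.div_mul_le_self (t * (removedLists e L (R.take (j + 1)) s).length +
      (removed e L (R.drop (j + 1)) s).length) t
    rw [← ht] at h6
    omega
  -- One more list from these levels would add a full `2 ^ t` to the numerator of the tick, so all
  -- new removals come from the finer levels, which are counted by elements.
  have h6 : (removedLists e L (R.take (j + 1)) s').length =
      (removedLists e L (R.take (j + 1)) s).length := by
    refine le_antisymm ?_ h3
    by_contra hlt
    have := Nat.mul_le_mul_left t (Nat.succ_le_of_lt (not_le.1 hlt))
    rw [Nat.succ_eq_add_one, mul_add] at this
    omega
  have h7 : removed e L (R.take (j + 1)) s' = removed e L (R.take (j + 1)) s := by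
    rw [removed, removed, h1.eq_of_length h6.symm]
  have h8 := h2.card_toFinset_sdiff_le
  rw [h6] at h5
  refine lt_of_le_of_lt (Finset.card_le_card ?_) (by omega :
    ((removed e L (R.drop (j + 1)) s').toFinset \
      (removed e L (R.drop (j + 1)) s).toFinset).card < t)
  have h9 : ∀ s, removed e L R s =
      removed e L (R.take (j + 1)) s ++ removed e L (R.drop (j + 1)) s := by
    intro s
    rw [← removed_append, List.take_append_drop]
  intro x
  rw [h9 s', h9 s, h7]
  simp only [Finset.mem_sdiff, List.mem_toFinset, List.mem_append]
  tauto

/-- The elements of `X` that have not been removed by stage `s`. -/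
def survivors (e : Nat.Partrec.Code) (L : List (List ℕ)) (R : List (ℕ × ℕ × ℕ)) (X : List ℕ)
    (s : ℕ) : Finset ℕ := X.toFinset \ (removed e L R s).toFinset

theorem survivors_anti {X : List ℕ} {s s' : ℕ} (h : s ≤ s') :
    survivors e L R X s' ⊆ survivors e L R X s :=
  Finset.sdiff_subset_sdiff subset_rfl fun _ hx =>
    List.mem_toFinset.2 ((removed_sublist h).subset (List.mem_toFinset.1 hx))

/-- Every list in `L` has small covers by members of `L`. -/
def HasCovers (L : List (List ℕ)) (a : ℕ) : Prop := ∀ A ∈ L, ∀ c, 0 < c → c ≤ A.length →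
  ∃ W : Finset (List ℕ), (∀ B ∈ W, B ∈ L ∧ B.length ≤ c) ∧ (∀ i ∈ A, ∃ B ∈ W, i ∈ B) ∧
    2 * W.card * c ≤ 2 ^ a * A.length

/-- Averaging: if every member of a cover of `A` held fewer than `2 ^ (t' + 1)` elements of `Y`,
then `Y` would be too small. The factor 2 in `HasCovers` pays for the exponent `t' + 1` in place of
`t'`. -/
theorem HasCovers.exists_rich {a : ℕ} (hL : HasCovers L a) (ha : 0 < a) {A : List ℕ} (hA : A ∈ L)
    {Y : Finset ℕ} (hY : ∀ y ∈ Y, y ∈ A) {l t l' t' : ℕ} (hl : A.length ≤ 2 ^ l)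
    (ht : 2 ^ t ≤ Y.card) (hll : l' ≤ l) (htt : t' + a + l ≤ t + l') :
    ∃ B ∈ L, B.length ≤ 2 ^ l' ∧ 2 ^ (t' + 1) ≤ (Y.filter (· ∈ B)).card := by
  rcases le_or_gt A.length (2 ^ l') with h | h
  · refine ⟨A, hA, h, ?_⟩
    rw [Finset.filter_true_of_mem hY]
    -- Positivity of `a` gives `t' + 1 ≤ t` here.
    exact (Nat.pow_le_pow_right (by norm_num) (by omega)).trans ht
  · obtain ⟨W, hW, hcov, hcard⟩ := hL A hA (2 ^ l') (by positivity) h.le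
    by_contra! hno
    have h1 : Y.card ≤ W.card * (2 ^ (t' + 1) - 1) := by
      have h2 : Y ⊆ W.biUnion fun B => Y.filter (· ∈ B) := by
        intro y hy
        obtain ⟨B, hB, hyB⟩ := hcov y (hY y hy)
        exact Finset.mem_biUnion.2 ⟨B, hB, Finset.mem_filter.2 ⟨hy, hyB⟩⟩
      refine (Finset.card_le_card h2).trans (Finset.card_biUnion_le_card_mul _ _ _ fun B hB => ?_)
      exact Nat.le_sub_one_of_lt (hno B (hW B hB).1 (hW B hB).2)
    have h2 : Y.card < W.card * 2 ^ (t' + 1) := by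
      have hWpos : 0 < W.card := by
        by_contra h0
        have hW0 : W.card = 0 := by omega
        rw [hW0, zero_mul] at h1
        have : 0 < 2 ^ t := by positivity
        omega
      exact h1.trans_lt (Nat.mul_lt_mul_of_pos_left (Nat.sub_lt (by positivity) one_pos) hWpos)
    have h3 : 2 ^ (t + l') < 2 ^ (t' + a + l) := by
      calc 2 ^ (t + l') = 2 ^ t * 2 ^ l' := pow_add _ _ _
        _ ≤ Y.card * 2 ^ l' := Nat.mul_le_mul_right _ ht
        _ < W.card * 2 ^ (t' + 1) * 2 ^ l' := Nat.mul_lt_mul_of_pos_right h2 (by positivity)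
        _ = 2 ^ t' * (2 * W.card * 2 ^ l') := by ring
        _ ≤ 2 ^ t' * (2 ^ a * A.length) := Nat.mul_le_mul_left _ hcard
        _ ≤ 2 ^ t' * (2 ^ a * 2 ^ l) := by gcongr
        _ = 2 ^ (t' + a + l) := by ring
    have := (Nat.pow_lt_pow_iff_right (by norm_num : 1 < 2)).1 h3
    omega

/-- At the last change `X` had at least as many survivors as at `S`, so a member with twice the
required number existed then. With the clock unchanged since, fewer than half of these can have been
lost. Only the invariant at `S` is used; there is no induction over stages. -/
theorem richMember_spec {a : ℕ} (hL : HasCovers L a) (ha : 0 < a) {X A : List ℕ}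
    (hX : X.Nodup) (hA : A ∈ L) (hXA : ∀ x ∈ X, x ∈ A) {l t j S : ℕ} (hl : A.length ≤ 2 ^ l)
    (ht : 2 ^ t ≤ (survivors e L R X S).card) (hll : (R.getD j 0).1 ≤ l)
    (htt : (R.getD j 0).2.2 + a + l ≤ t + (R.getD j 0).1) :
    let B := richMember e L R X j (lastChange e L R j S)
    B ∈ L ∧ B.length ≤ 2 ^ (R.getD j 0).1 ∧ 2 ^ (R.getD j 0).2.2 ≤
      (survivors e L R (X.filter fun x => decide (x ∈ B)) S).card := by
  intro B
  set T := lastChange e L R j S with hT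
  have hTS : T ≤ S := lastChange_le j S
  have hlen : ∀ C : List ℕ, (X.filter fun x => decide (x ∈ C ∧ x ∉ removed e L R T)).length =
      ((survivors e L R X T).filter (· ∈ C)).card := by
    intro C
    rw [← List.toFinset_card_of_nodup (hX.filter _)]
    congr 1
    ext x
    simp only [survivors, List.mem_toFinset, List.mem_filter, decide_eq_true_eq,
      Finset.mem_filter, Finset.mem_sdiff]
    tauto
  obtain ⟨C, hC, hCl, hCr⟩ := hL.exists_rich ha hA (Y := survivors e L R X T)
    (fun y hy => hXA y (List.mem_toFinset.1 (Finset.mem_sdiff.1 hy).1)) hl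
    (ht.trans (Finset.card_le_card (survivors_anti hTS))) hll htt
  have hB : B ∈ L.filter fun A => decide (A.length ≤ 2 ^ (R.getD j 0).1 ∧
      2 ^ ((R.getD j 0).2.2 + 1) ≤
        (X.filter fun x => decide (x ∈ A ∧ x ∉ removed e L R T)).length) := by
    have hC' : C ∈ L.filter fun A => decide (A.length ≤ 2 ^ (R.getD j 0).1 ∧
      2 ^ ((R.getD j 0).2.2 + 1) ≤
        (X.filter fun x => decide (x ∈ A ∧ x ∉ removed e L R T)).length) := by
      simp only [List.mem_filter, decide_eq_true_eq]
      exact ⟨hC, hCl, by rwa [hlen]⟩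
    -- The filtered list is nonempty, so `richMember` returns its head and not the default `[]`.
    have hne := List.ne_nil_of_mem hC'
    change (List.head? _).getD [] ∈ _
    rw [List.head?_eq_some_head hne, Option.getD_some]
    exact List.head_mem hne
  simp only [List.mem_filter, decide_eq_true_eq, hlen] at hB
  refine ⟨hB.1, hB.2.1, ?_⟩
  have h1 := card_removed_sdiff_lt (e := e) (L := L) (R := R) hTS
    (tick_eq_of_clock_eq hTS (clock_lastChange j S))
  have h2 : (survivors e L R X T).filter (· ∈ B) ⊆
      survivors e L R (X.filter fun x => decide (x ∈ B)) S ∪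
        ((removed e L R S).toFinset \ (removed e L R T).toFinset) := by
    intro x
    simp only [survivors, List.mem_toFinset, List.mem_filter, decide_eq_true_eq,
      Finset.mem_filter, Finset.mem_sdiff, Finset.mem_union]
    tauto
  have h3 := (Finset.card_le_card h2).trans (Finset.card_union_le _ _)
  have h4 := hB.2.2
  rw [pow_succ] at h4
  omega

end ChainCorrectness

/-! ### Counting changes and survivors for suitable parameters -/

section LevelData

variable {e : Nat.Partrec.Code} {L : List (List ℕ)} {R : List (ℕ × ℕ × ℕ)}

theorem length_removedLists_mul_le {D W : ℕ} (h : ∀ r ∈ R, (2 ^ r.2.1 - 1) * D ≤ W) (s : ℕ) :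
    (removedLists e L R s).length * D ≤ R.length * W := by
  induction R with
  | nil => simp [removedLists]
  | cons r R ih =>
    have h1 := ih fun r' hr' => h r' (List.mem_cons_of_mem _ hr')
    have h2 := (Nat.mul_le_mul_right D (List.length_filterMap_le (printedWithin e L r.1 s)
      (List.range (2 ^ r.2.1 - 1)))).trans
      ((List.length_range (n := 2 ^ r.2.1 - 1)).symm ▸ h r List.mem_cons_self)
    simp only [removedLists, List.flatMap_cons, List.length_append, List.length_cons] at h1 ⊢
    rw [add_mul, add_mul]
    omega

theorem length_removed_mul_le {D W : ℕ} (h : ∀ r ∈ R, (2 ^ r.2.1 - 1) * 2 ^ r.1 * D ≤ W)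
    (s : ℕ) : (removed e L R s).length * D ≤ R.length * W := by
  induction R with
  | nil => simp [removed, removedLists]
  | cons r R ih =>
    have h1 := ih fun r' hr' => h r' (List.mem_cons_of_mem _ hr')
    have h2 : ((List.range (2 ^ r.2.1 - 1)).filterMap (printedWithin e L r.1 s)).flatten.length ≤
        (2 ^ r.2.1 - 1) * 2 ^ r.1 := by
      rw [List.length_flatten]
      refine (List.sum_le_card_nsmul _ (2 ^ r.1) ?_).trans ?_
      · intro m hm
        obtain ⟨z, hz, rfl⟩ := List.mem_map.1 hm
        obtain ⟨p, -, hp⟩ := List.mem_filterMap.1 hz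
        exact (printedWithin_spec hp).2
      · rw [List.length_map, smul_eq_mul]
        refine Nat.mul_le_mul_right _ ((List.length_filterMap_le _ _).trans ?_)
        rw [List.length_range]
    have h3 := (Nat.mul_le_mul_right D h2).trans (h r List.mem_cons_self)
    simp only [removed, removedLists, List.flatMap_cons, List.flatten_append, List.length_append,
      List.length_cons] at h1 ⊢
    rw [add_mul, add_mul]
    omega

/-- The `- 1` saves the case `g < δ`, where the truncated difference is 0: such a level removes
nothing. -/
theorem two_pow_sub_mul_le (g δ : ℕ) : (2 ^ (g - δ) - 1) * 2 ^ δ ≤ 2 ^ g := by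
  rcases le_total g δ with h | h
  · simp [Nat.sub_eq_zero_of_le h]
  · calc (2 ^ (g - δ) - 1) * 2 ^ δ ≤ 2 ^ (g - δ) * 2 ^ δ := Nat.mul_le_mul_right _ (Nat.sub_le _ _)
      _ = 2 ^ g := by rw [← pow_add, Nat.sub_add_cancel h]

/-- Levels `ℓ 0 = n > ℓ 1 > …` with target complexities `g` and survival thresholds `t`, for
sets whose covers cost a factor `2 ^ a`. -/
structure IsLevelData (n M a δ : ℕ) (ℓ g t : ℕ → ℕ) : Prop where
  ℓ_zero : ℓ 0 = n
  g_zero : g 0 = 0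
  -- Each level costs a factor `2 ^ a` of survivors; the 1 stands for the half of the cube that may
  -- be removed altogether.
  t_add : ∀ j ≤ M, t j + a * j + 1 = ℓ j
  ℓ_anti : Antitone ℓ
  g_mono : Monotone g
  sum_anti : Antitone fun j => g j + ℓ j
  a_pos : 0 < a
  δ_ge : a * M + 2 + 2 * M.size ≤ δ

/-- The levels `1, …, M` as a list of triples. -/
def levelList (M δ : ℕ) (ℓ g t : ℕ → ℕ) : List (ℕ × ℕ × ℕ) :=
  (List.range M).map fun j => (ℓ (j + 1), g (j + 1) - δ, t (j + 1))

variable {n M a δ : ℕ} {ℓ g t : ℕ → ℕ}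

theorem getD_levelList {j : ℕ} (hj : j < M) :
    (levelList M δ ℓ g t).getD j 0 = (ℓ (j + 1), g (j + 1) - δ, t (j + 1)) := by
  simp [levelList, List.getD_eq_getElem?_getD, List.getElem?_range hj]

theorem mem_take_levelList {j : ℕ} {r : ℕ × ℕ × ℕ}
    (hr : r ∈ (levelList M δ ℓ g t).take (j + 1)) :
    ∃ i ≤ j, r = (ℓ (i + 1), g (i + 1) - δ, t (i + 1)) := by
  rw [levelList, ← List.map_take, List.take_range, List.mem_map] at hr
  obtain ⟨i, hi, rfl⟩ := hr
  exact ⟨i, by rw [List.mem_range] at hi; omega, rfl⟩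

theorem mem_drop_levelList {j : ℕ} {r : ℕ × ℕ × ℕ}
    (hr : r ∈ (levelList M δ ℓ g t).drop j) :
    ∃ i, j ≤ i ∧ r = (ℓ (i + 1), g (i + 1) - δ, t (i + 1)) := by
  obtain ⟨i, hi, rfl⟩ := List.mem_iff_getElem.1 hr
  refine ⟨j + i, by omega, ?_⟩
  simp [levelList]

theorem length_levelList : (levelList M δ ℓ g t).length = M := by simp [levelList]

theorem IsLevelData.sum_le (hd : IsLevelData n M a δ ℓ g t) (j : ℕ) : g j + ℓ j ≤ n := by
  have := hd.sum_anti (Nat.zero_le j)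
  simpa [hd.ℓ_zero, hd.g_zero] using this

theorem IsLevelData.size_bound (hd : IsLevelData n M a δ ℓ g t) :
    M * M * 2 ^ (a * M + 2) ≤ 2 ^ δ := by
  have h1 := (Nat.lt_size_self M).le
  calc M * M * 2 ^ (a * M + 2) ≤ 2 ^ M.size * 2 ^ M.size * 2 ^ (a * M + 2) := by gcongr
    _ = 2 ^ (a * M + 2 + 2 * M.size) := by ring
    _ ≤ 2 ^ δ := Nat.pow_le_pow_right (by norm_num) hd.δ_ge

/-- List position `j` is level `j + 1`. Up to this level the number of removals is bounded since `g`
is monotone. Finer levels remove at most `M * 2 ^ (g (j + 1) + ℓ (j + 1)) / 2 ^ δ` elements since `g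
+ ℓ` is antitone, and division by `2 ^ t (j + 1)` leaves the loss `a * (j + 1) + 1` in the exponent.
-/
theorem IsLevelData.tick_mul_le (hd : IsLevelData n M a δ ℓ g t) {j : ℕ} (hj : j < M) (s : ℕ) :
    tick e L (levelList M δ ℓ g t) j s * 2 ^ δ ≤ M * 2 ^ (g (j + 1) + a * M + 2) := by
  set R := levelList M δ ℓ g t with hR
  have h1 : (removedLists e L (R.take (j + 1)) s).length * 2 ^ δ ≤ M * 2 ^ g (j + 1) := by
    refine (length_removedLists_mul_le (W := 2 ^ g (j + 1)) ?_ s).trans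
      (Nat.mul_le_mul_right _ ?_)
    · intro r hr
      obtain ⟨i, hi, rfl⟩ := mem_take_levelList hr
      exact (two_pow_sub_mul_le _ _).trans
        (Nat.pow_le_pow_right (by norm_num) (hd.g_mono (by omega)))
    · exact (List.length_take_le' _ _).trans length_levelList.le
  have h2 : (removed e L (R.drop (j + 1)) s).length * 2 ^ δ ≤
      M * 2 ^ (g (j + 1) + ℓ (j + 1)) := by
    refine (length_removed_mul_le (W := 2 ^ (g (j + 1) + ℓ (j + 1))) ?_ s).trans
      (Nat.mul_le_mul_right _ ?_)
    · intro r hr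
      obtain ⟨i, hi, rfl⟩ := mem_drop_levelList hr
      calc (2 ^ (g (i + 1) - δ) - 1) * 2 ^ ℓ (i + 1) * 2 ^ δ
          = (2 ^ (g (i + 1) - δ) - 1) * 2 ^ δ * 2 ^ ℓ (i + 1) := by ring
        _ ≤ 2 ^ g (i + 1) * 2 ^ ℓ (i + 1) := Nat.mul_le_mul_right _ (two_pow_sub_mul_le _ _)
        _ = 2 ^ (g (i + 1) + ℓ (i + 1)) := (pow_add _ _ _).symm
        _ ≤ _ := Nat.pow_le_pow_right (by norm_num)
          (hd.sum_anti (show j + 1 ≤ i + 1 by omega))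
    · rw [List.length_drop, length_levelList]; omega
  have ht := hd.t_add (j + 1) (by omega)
  have hgt : (R.getD j 0).2.2 = t (j + 1) := by rw [hR, getD_levelList hj]
  have h3 : tick e L R j s * 2 ^ t (j + 1) ≤
      2 ^ t (j + 1) * (removedLists e L (R.take (j + 1)) s).length +
        (removed e L (R.drop (j + 1)) s).length := by
    rw [tick, hgt]
    exact Nat.div_mul_le_self _ _
  have h4 : a * (j + 1) ≤ a * M := Nat.mul_le_mul_left _ hj
  refine Nat.le_of_mul_le_mul_right (c := 2 ^ t (j + 1)) ?_ (by positivity)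
  calc tick e L R j s * 2 ^ δ * 2 ^ t (j + 1) = tick e L R j s * 2 ^ t (j + 1) * 2 ^ δ := by ring
    _ ≤ (2 ^ t (j + 1) * (removedLists e L (R.take (j + 1)) s).length +
        (removed e L (R.drop (j + 1)) s).length) * 2 ^ δ := Nat.mul_le_mul_right _ h3
    _ = 2 ^ t (j + 1) * ((removedLists e L (R.take (j + 1)) s).length * 2 ^ δ) +
        (removed e L (R.drop (j + 1)) s).length * 2 ^ δ := by ring
    _ ≤ 2 ^ t (j + 1) * (M * 2 ^ g (j + 1)) + M * 2 ^ (g (j + 1) + ℓ (j + 1)) := by gcongr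
    _ = M * (2 ^ (t (j + 1) + g (j + 1)) + 2 ^ (g (j + 1) + ℓ (j + 1))) := by ring
    _ ≤ M * (2 ^ (t (j + 1) + g (j + 1) + a * M + 1) +
        2 ^ (t (j + 1) + g (j + 1) + a * M + 1)) :=
      Nat.mul_le_mul_left _ (add_le_add (Nat.pow_le_pow_right (by norm_num) (by omega))
        (Nat.pow_le_pow_right (by norm_num) (by omega)))
    _ = _ := by ring

/-- The clock adds at most `M` ticks, and `δ` was chosen to absorb the resulting factor `M * M * 2 ^
(a * M + 2)`. -/
theorem IsLevelData.clock_le (hd : IsLevelData n M a δ ℓ g t) {i : ℕ} (hi : i < M) (s : ℕ) :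
    clock e L (levelList M δ ℓ g t) i s ≤ 2 ^ g (i + 1) := by
  have h1 : ∀ j ≤ i, clock e L (levelList M δ ℓ g t) j s * 2 ^ δ ≤
      (j + 1) * (M * 2 ^ (g (i + 1) + a * M + 2)) := by
    have h2 : ∀ j ≤ i, tick e L (levelList M δ ℓ g t) j s * 2 ^ δ ≤
        M * 2 ^ (g (i + 1) + a * M + 2) := by
      intro j hj
      refine (hd.tick_mul_le (by omega) s).trans (Nat.mul_le_mul_left _
        (Nat.pow_le_pow_right (by norm_num) ?_))
      have := hd.g_mono (show j + 1 ≤ i + 1 by omega)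
      omega
    intro j hj
    induction j with
    | zero => simpa [clock_zero] using h2 0 hj
    | succ j ih =>
      rw [clock_succ, add_mul, add_mul _ 1, one_mul]
      exact add_le_add (ih (by omega)) (h2 _ hj)
  refine Nat.le_of_mul_le_mul_right (c := 2 ^ δ) ?_ (by positivity)
  calc clock e L (levelList M δ ℓ g t) i s * 2 ^ δ
      ≤ (i + 1) * (M * 2 ^ (g (i + 1) + a * M + 2)) := h1 i le_rfl
    _ ≤ M * (M * 2 ^ (g (i + 1) + a * M + 2)) := Nat.mul_le_mul_right _ hi
    _ = 2 ^ g (i + 1) * (M * M * 2 ^ (a * M + 2)) := by ring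
    _ ≤ 2 ^ g (i + 1) * 2 ^ δ := Nat.mul_le_mul_left _ hd.size_bound

theorem nodup_cubeList (n : ℕ) : (cubeList n).Nodup := (List.nodup_range).filter _

theorem length_cubeList (n : ℕ) : (cubeList n).length = 2 ^ n := by
  rw [cubeList_eq, length_listing, card_cube]

theorem IsLevelData.card_survivors_cube (hd : IsLevelData n M a δ ℓ g t) (s : ℕ) :
    2 ^ t 0 ≤ (survivors e L (levelList M δ ℓ g t) (cubeList n) s).card := by
  have ht : t 0 + 1 = n := by simpa [hd.ℓ_zero] using hd.t_add 0 (Nat.zero_le _)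
  have h1 : (removed e L (levelList M δ ℓ g t) s).length * 2 ^ δ ≤ M * 2 ^ n := by
    refine (length_removed_mul_le (W := 2 ^ n) ?_ s).trans
      (Nat.mul_le_mul_right _ length_levelList.le)
    intro r hr
    obtain ⟨i, -, rfl⟩ := mem_drop_levelList (j := 0) (by simpa using hr)
    calc (2 ^ (g (i + 1) - δ) - 1) * 2 ^ ℓ (i + 1) * 2 ^ δ
        = (2 ^ (g (i + 1) - δ) - 1) * 2 ^ δ * 2 ^ ℓ (i + 1) := by ring
      _ ≤ 2 ^ g (i + 1) * 2 ^ ℓ (i + 1) := Nat.mul_le_mul_right _ (two_pow_sub_mul_le _ _)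
      _ = 2 ^ (g (i + 1) + ℓ (i + 1)) := (pow_add _ _ _).symm
      _ ≤ _ := Nat.pow_le_pow_right (by norm_num) (hd.sum_le _)
  have h2 : (removed e L (levelList M δ ℓ g t) s).length ≤ 2 ^ t 0 := by
    refine Nat.le_of_mul_le_mul_right (c := 2 ^ δ) (h1.trans ?_) (by positivity)
    have h3 : M * 2 ≤ 2 ^ δ := by
      calc M * 2 ≤ 2 ^ M.size * 2 ^ 1 := by
            have := (Nat.lt_size_self M).le
            omega
        _ = 2 ^ (M.size + 1) := by ring
        _ ≤ _ := Nat.pow_le_pow_right (by norm_num) (by have := hd.δ_ge; omega)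
    rw [← ht, pow_succ]
    nlinarith [Nat.mul_le_mul_right (2 ^ t 0) h3]
  have h3 := Finset.le_card_sdiff (removed e L (levelList M δ ℓ g t) s).toFinset
    (cubeList n).toFinset
  rw [List.toFinset_card_of_nodup (nodup_cubeList n), length_cubeList] at h3
  have h4 := List.toFinset_card_le (removed e L (levelList M δ ℓ g t) s)
  unfold survivors
  rw [← ht, pow_succ] at h3
  rw [← ht]
  omega

/-- Induction on the level with the stage fixed. The chain lies inside the latest chosen member (at
first the cube), and a cover of that member yields the next one. -/
theorem IsLevelData.chain_spec (hd : IsLevelData n M a δ ℓ g t) (hL : HasCovers L a)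
    (hcube : cubeList n ∈ L) (S : ℕ) : ∀ j ≤ M,
      2 ^ t j ≤ (survivors e L (levelList M δ ℓ g t)
        (chain e L (levelList M δ ℓ g t) n S j) S).card ∧
      (chain e L (levelList M δ ℓ g t) n S j).Nodup ∧
      (∃ A ∈ L, A.length ≤ 2 ^ ℓ j ∧ ∀ x ∈ chain e L (levelList M δ ℓ g t) n S j, x ∈ A) ∧
      (∀ x ∈ chain e L (levelList M δ ℓ g t) n S j, x ∈ cubeList n) ∧
      ∀ i < j, chainMember e L (levelList M δ ℓ g t) n S i ∈ L ∧
        (chainMember e L (levelList M δ ℓ g t) n S i).length ≤ 2 ^ ℓ (i + 1) ∧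
        ∀ x ∈ chain e L (levelList M δ ℓ g t) n S j,
          x ∈ chainMember e L (levelList M δ ℓ g t) n S i := by
  intro j hj
  induction j with
  | zero => exact ⟨hd.card_survivors_cube S, nodup_cubeList n, ⟨cubeList n, hcube,
      by rw [length_cubeList, hd.ℓ_zero], fun x hx => hx⟩, fun x hx => hx, by simp⟩
  | succ j ih =>
    obtain ⟨h1, h2, ⟨A, hA, hAl, hXA⟩, h3, h4⟩ := ih (by omega)
    have hgd := getD_levelList (δ := δ) (ℓ := ℓ) (g := g) (t := t) (show j < M by omega)
    have ht1 := hd.t_add j (by omega)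
    have ht2 := hd.t_add (j + 1) hj
    have hspec := richMember_spec (j := j) hL hd.a_pos h2 hA hXA hAl h1
      (by rw [hgd]; exact hd.ℓ_anti (Nat.le_succ j))
      (by rw [hgd]; simp only; rw [mul_add] at ht2; omega)
    rw [hgd] at hspec
    have hsub : ∀ x ∈ chain e L (levelList M δ ℓ g t) n S (j + 1),
        x ∈ chain e L (levelList M δ ℓ g t) n S j ∧
          x ∈ chainMember e L (levelList M δ ℓ g t) n S j := by
      intro x hx
      simpa [chain, chainMember] using hx
    refine ⟨hspec.2.2, h2.filter _, ⟨_, hspec.1, hspec.2.1, fun x hx => (hsub x hx).2⟩,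
      fun x hx => h3 x (hsub x hx).1, fun i hi => ?_⟩
    rcases Nat.lt_succ_iff_lt_or_eq.1 hi with hi | rfl
    · exact ⟨(h4 i hi).1, (h4 i hi).2.1, fun x hx => (h4 i hi).2.2 x (hsub x hx).1⟩
    · exact ⟨hspec.1, hspec.2.1, fun x hx => (hsub x hx).2⟩

theorem IsLevelData.exists_survivor (hd : IsLevelData n M a δ ℓ g t) (hL : HasCovers L a)
    (hcube : cubeList n ∈ L) (S : ℕ) :
    ∃ x ∈ cubeList n, x ∉ removed e L (levelList M δ ℓ g t) S ∧
      ∀ i < M, chainMember e L (levelList M δ ℓ g t) n S i ∈ L ∧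
        (chainMember e L (levelList M δ ℓ g t) n S i).length ≤ 2 ^ ℓ (i + 1) ∧
        x ∈ chainMember e L (levelList M δ ℓ g t) n S i := by
  obtain ⟨h1, -, -, h3, h4⟩ := hd.chain_spec (e := e) hL hcube S M le_rfl
  obtain ⟨x, hx⟩ := Finset.card_pos.1 (lt_of_lt_of_le (by positivity) h1)
  simp only [survivors, Finset.mem_sdiff, List.mem_toFinset] at hx
  exact ⟨x, h3 x hx.1, hx.2, fun i hi => ⟨(h4 i hi).1, (h4 i hi).2.1, (h4 i hi).2.2 x hx.1⟩⟩

end LevelData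

/-! ### Strings with a prescribed rate-distortion function -/

theorem exists_code_numMachine {U : Str →. Str} (hU : Partrec U) :
    ∃ e : Nat.Partrec.Code, e.eval = numMachine U :=
  Nat.Partrec.Code.exists_code.1 (Partrec.nat_iff.1 (partrec_numMachine hU))

/-- This stage is not computable from `P`; it enters descriptions only through clock readings. -/
theorem exists_stage (e : Nat.Partrec.Code) (P : ℕ) :
    ∃ S, ∀ p < P, ∀ y ∈ e.eval p, y ∈ e.evaln S p := by
  induction P with
  | zero => exact ⟨0, by simp⟩
  | succ P ih =>
    obtain ⟨S, hS⟩ := ih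
    by_cases hd : (e.eval P).Dom
    · obtain ⟨k, hk⟩ := Nat.Partrec.Code.evaln_complete.1 (Part.get_mem hd)
      refine ⟨max S k, fun p hp y hy => ?_⟩
      rcases Nat.lt_succ_iff_lt_or_eq.1 hp with hp | rfl
      · exact Nat.Partrec.Code.evaln_mono (le_max_left _ _) (hS p hp y hy)
      · rw [Part.mem_unique hy (Part.get_mem hd)]
        exact Nat.Partrec.Code.evaln_mono (le_max_right _ _) hk
    · refine ⟨S, fun p hp y hy => ?_⟩
      rcases Nat.lt_succ_iff_lt_or_eq.1 hp with hp | rfl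
      · exact hS p hp y hy
      · exact absurd (Part.dom_iff_mem.2 ⟨y, hy⟩) hd

theorem hasCovers_familyLists {𝒜 : Set (Finset Str)} {n a : ℕ}
    (h : ∀ (c : ℕ) (A : Finset Str), 0 < c → A ∈ slice 𝒜 n → c ≤ A.card →
      ∃ ℬ ⊆ slice 𝒜 n, (∀ B ∈ ℬ, B.card ≤ c) ∧ (∀ x ∈ A, ∃ B ∈ ℬ, x ∈ B) ∧
        2 * ℬ.card * c ≤ 2 ^ a * A.card) :
    HasCovers (familyLists (listCode ((slice 𝒜 n).image setCode))) a := by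
  intro A hA c hc hcA
  obtain ⟨A, hA', rfl⟩ := mem_familyLists.1 hA
  rw [length_listing] at hcA ⊢
  obtain ⟨ℬ, h1, h2, h3, h4⟩ := h c A hc hA' hcA
  refine ⟨ℬ.image listing, fun B hB => ?_, fun i hi => ?_, ?_⟩
  · obtain ⟨D, hD, rfl⟩ := Finset.mem_image.1 hB
    exact ⟨listing_mem_familyLists.2 (h1 hD), by rw [length_listing]; exact h2 D hD⟩
  · obtain ⟨B, hB, hiB⟩ := h3 _ (mem_listing.1 hi)
    exact ⟨_, Finset.mem_image_of_mem _ hB, mem_listing.2 hiB⟩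
  · rwa [Finset.card_image_of_injective _ listing_injective]

theorem size_encode_triple_le {l k t n : ℕ} (hl : l ≤ n) (hk : k ≤ n) (ht : t ≤ n) :
    (Encodable.encode (l, k, t)).size ≤ 4 * n.size := by
  have hn := Nat.lt_size_self n
  have hpair : ∀ {x y w : ℕ}, x < 2 ^ w → y < 2 ^ w → Nat.pair x y < 2 ^ (w + w) := by
    intro x y w hx hy
    refine (Nat.pair_lt_max_add_one_sq x y).trans_le ?_
    rw [pow_add, ← sq]
    exact Nat.pow_le_pow_left (by omega) 2
  have h1 : Nat.pair k t < 2 ^ (n.size + n.size) := hpair (by omega) (by omega)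
  have h2 : l < 2 ^ (n.size + n.size) :=
    (hl.trans_lt hn).trans_le (Nat.pow_le_pow_right (by norm_num) (by omega))
  have h3 := hpair h2 h1
  rw [Nat.size_le]
  simp only [Encodable.encode_prod_val, Encodable.encode_nat]
  exact h3.trans_le (Nat.pow_le_pow_right (by norm_num) (by omega))

/-- The clock reading at `S`, at most `2 ^ g (i + 1)`, replaces the stage `S` and is the only part
written plainly. The levels are self-delimited parameters, whence the term with factor `M`. -/
theorem exists_chainMember_complexity_le {U : Str →. Str} (hU : IsReferenceMachine U)
    (e : Nat.Partrec.Code) : ∃ c : ℕ, ∀ (F : Finset (Finset Str)) (B : Finset Str)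
      (n M a δ i S : ℕ) (ℓ g t : ℕ → ℕ), IsLevelData n M a δ ℓ g t → i < M →
      chainMember e (familyLists (listCode (F.image setCode))) (levelList M δ ℓ g t) n S i =
        listing B →
      setComplexity U B ≤ g (i + 1) + 2 * familyComplexity U F + 4 * n.size +
        M * (8 * n.size + 2) + c := by
  obtain ⟨c, hc⟩ := complexity_le_of_partrec hU (partrec_clockedMember hU.1 e)
  refine ⟨c + 9, fun F B n M a δ i S ℓ g t hd hi hB => ?_⟩
  set L := familyLists (listCode (F.image setCode)) with hL
  set R := levelList M δ ℓ g t with hR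
  obtain ⟨p, hp, hpy⟩ := exists_numProgram hU (listCode (F.image setCode))
  set q := clock e L R i S with hq
  have hmap : (R.map Encodable.encode).map (Denumerable.ofNat (ℕ × ℕ × ℕ)) = R := by
    rw [List.map_map]
    exact (List.map_congr_left fun r _ => Denumerable.ofNat_encode r).trans (List.map_id _)
  have hmem : listCode B ∈ clockedMember U e (p :: n :: i :: R.map Encodable.encode, q) := by
    refine Part.mem_bind hpy ?_
    -- The machine may stop at `T` before `S`, but by monotonicity the clock shows exactly `q`
    -- there, so the same member is chosen.
    obtain ⟨T, hT, hTS⟩ := Nat.rfind_min' (p := fun s => decide (q ≤ clock e L R i s)) (m := S)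
      (by simp [hq])
    have hqT : q ≤ clock e L R i T := by simpa using Nat.rfind_spec hT
    have hTc : clock e L R i T = clock e L R i S := le_antisymm (clock_mono i hTS) hqT
    refine (Part.mem_map_iff _).2 ⟨T, ?_, ?_⟩
    · simp only [List.drop_succ_cons, List.drop_zero, hmap, List.getD_cons_zero,
        List.getD_cons_succ]
      exact hT
    · simp only [List.drop_succ_cons, List.drop_zero, hmap, List.getD_cons_zero,
        List.getD_cons_succ]
      rw [chainMember_congr hTS hTc, hB, listCode]
  have hmain := hc _ _ _ hmem
  rw [← setComplexity_eq] at hmain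
  have h1 : q.size ≤ g (i + 1) + 1 := by
    rw [Nat.size_le, pow_succ]
    have := hd.clock_le (e := e) (L := L) hi S
    rw [← hR, ← hq] at this
    have : 0 < 2 ^ g (i + 1) := by positivity
    omega
  have h2 := size_lt_pow hp
  rw [← setComplexity_eq] at h2
  have hMn : M ≤ n := by
    have h3 := hd.t_add M le_rfl
    have h4 := hd.sum_le M
    have h5 := Nat.le_mul_of_pos_left M hd.a_pos
    omega
  have h3 : i.size ≤ n.size := Nat.size_le_size (by omega)
  have h4 : ((R.map Encodable.encode).map fun a => 2 * a.size + 2).sum ≤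
      M * (8 * n.size + 2) := by
    refine (List.sum_le_card_nsmul _ (8 * n.size + 2) ?_).trans ?_
    · intro m hm
      obtain ⟨z, hz, rfl⟩ := List.mem_map.1 hm
      obtain ⟨r, hr, rfl⟩ := List.mem_map.1 hz
      obtain ⟨j, hj, hr⟩ := List.mem_map.1 hr
      rw [List.mem_range] at hj
      have h5 := hd.sum_le (j + 1)
      have h6 := hd.t_add (j + 1) hj
      rw [← hr]
      have := size_encode_triple_le (n := n) (l := ℓ (j + 1)) (k := g (j + 1) - δ)
        (t := t (j + 1)) (by omega) (by omega) (by omega)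
      omega
    · rw [List.length_map, List.length_map, hR, length_levelList, smul_eq_mul]
  simp only [List.map_cons, List.sum_cons] at hmain
  unfold familyComplexity
  omega

/-- A simpler set containing `x` would have a short program that halts within `S` steps, and `x`
would have been removed with it. -/
theorem le_canonicalRD_of_notMem_removed {U : Str →. Str} (hU : IsReferenceMachine U)
    {𝒜 : Set (Finset Str)} (h1 : ContainsCubes 𝒜) (h2 : EqualLengths 𝒜)
    (h4 : PolynomialCovering 𝒜) {e : Nat.Partrec.Code} (he : e.eval = numMachine U) {x : Str}
    {S : ℕ} {R : List (ℕ × ℕ × ℕ)}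
    (hS : ∀ r ∈ R, ∀ p < 2 ^ r.2.1, ∀ y ∈ e.eval p, y ∈ e.evaln S p)
    (hx : strToNat x ∉ removed e
      (familyLists (listCode ((slice 𝒜 x.length).image setCode))) R S)
    {r : ℕ × ℕ × ℕ} (hr : r ∈ R) (hl : r.1 ≤ x.length) :
    r.2.1 ≤ canonicalRD U 𝒜 x r.1 := by
  by_contra! hlt
  obtain ⟨B, hB, hxB, hBl, hC⟩ := exists_canonicalRD_eq U h1 h2 h4 hl
  obtain ⟨p, hp, hpB⟩ := exists_numProgram hU (listCode B)
  rw [← setComplexity_eq, hC] at hp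
  have hp' : p + 1 < 2 ^ r.2.1 :=
    hp.trans_le (Nat.pow_le_pow_right (by norm_num) (by omega))
  rw [← he] at hpB
  have hev := hS r hr p (by omega) _ hpB
  have hpr : printedWithin e (familyLists (listCode ((slice 𝒜 x.length).image setCode)))
      r.1 S p = some (listing B) := by
    simp only [printedWithin, Option.bind_eq_some_iff]
    exact ⟨_, hev, listing B, by rw [listCode, Encodable.encodek],
      if_pos ⟨listing_mem_familyLists.2 hB, by rwa [length_listing]⟩⟩
  refine hx (List.mem_flatten.2 ⟨listing B, List.mem_flatMap.2 ⟨r, hr, ?_⟩,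
    strToNat_mem_listing.2 hxB⟩)
  exact List.mem_filterMap.2 ⟨p, List.mem_range.2 (by omega), hpr⟩

theorem exists_string_of_levels {U : Str →. Str} (hU : IsReferenceMachine U)
    {𝒜 : Set (Finset Str)} (h1 : ContainsCubes 𝒜) (h2 : EqualLengths 𝒜)
    (h3 : SimpleSlices U 𝒜) (h4 : PolynomialCovering 𝒜) :
    ∃ b c : ℕ, 0 < b ∧ ∀ (n M δ : ℕ) (ℓ g t : ℕ → ℕ),
      IsLevelData n M (b * (n.size + 1)) δ ℓ g t → ∃ x : Str, x.length = n ∧ ∀ i < M,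
        g (i + 1) ≤ canonicalRD U 𝒜 x (ℓ (i + 1)) + δ ∧
        canonicalRD U 𝒜 x (ℓ (i + 1)) ≤
          g (i + 1) + c * (n.size + 1) + M * (8 * n.size + 2) := by
  obtain ⟨b, hb, hcov⟩ := exists_slice_cover h2 h4
  obtain ⟨e, he⟩ := exists_code_numMachine hU.1
  obtain ⟨c, hc⟩ := exists_chainMember_complexity_le hU e
  obtain ⟨c', hc'⟩ := exists_familyComplexity_le h3
  refine ⟨b, 2 * c' + 4 + c, hb, fun n M δ ℓ g t hd => ?_⟩
  set F := slice 𝒜 n with hF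
  -- Since `g + ℓ ≤ n`, all programs used for removals have numbers below `2 ^ n`.
  obtain ⟨S, hS⟩ := exists_stage e (2 ^ n)
  obtain ⟨m, hm, hmr, hchain⟩ := hd.exists_survivor (e := e)
    (hasCovers_familyLists fun c A => hcov n c A)
    (by rw [cubeList_eq]; exact listing_mem_familyLists.2 (cube_mem_slice h1 n)) S
  have hxn : (natToStr m).length = n := by
    rw [cubeList_eq, mem_listing, mem_cube] at hm
    exact hm
  refine ⟨natToStr m, hxn, fun i hi => ⟨?_, ?_⟩⟩
  · have hmem : (ℓ (i + 1), g (i + 1) - δ, t (i + 1)) ∈ levelList M δ ℓ g t :=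
      List.mem_map.2 ⟨i, List.mem_range.2 hi, rfl⟩
    have h5 := hd.sum_le (i + 1)
    have := le_canonicalRD_of_notMem_removed hU h1 h2 h4 he (x := natToStr m) (S := S)
      (R := levelList M δ ℓ g t) (fun r hr p hp => hS p (hp.trans_le ?_))
      (by rw [hxn, strToNat_natToStr]; exact hmr) hmem (by rw [hxn]; simp only; omega)
    · simp only at this
      omega
    · obtain ⟨j, -, rfl⟩ := List.mem_map.1 hr
      have h6 := hd.sum_le (j + 1)
      exact Nat.pow_le_pow_right (by norm_num) (by simp only; omega)
  · obtain ⟨hmem, hlen, hx⟩ := hchain i hi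
    obtain ⟨B, hB, hBl⟩ := mem_familyLists.1 hmem
    have h5 := hc F B n M _ δ i S ℓ g t hd hi hBl.symm
    rw [← hBl, length_listing] at hlen
    rw [← hBl, mem_listing] at hx
    have h6 := canonicalRD_le (U := U) (mem_slice.1 hB).1 hx hlen
    have h7 := hc' n
    nlinarith [Nat.zero_le (c * n.size)]

/-! ### Choice of the levels and interpolation between them -/

/-- The extension of a shape by its last value. -/
def shapeExt {n : ℕ} (g : Fin (n + 1) → ℕ) (l : ℕ) : ℕ := g ⟨min l n, by omega⟩

theorem shapeExt_val {n : ℕ} (g : Fin (n + 1) → ℕ) (l : Fin (n + 1)) :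
    shapeExt g l = g l := by
  unfold shapeExt
  congr
  have := l.2
  exact min_eq_left (by omega)

theorem shapeExt_succ {n : ℕ} {g : Fin (n + 1) → ℕ} (hg : g ∈ shapes n) {l : ℕ} (hl : l < n) :
    shapeExt g l = shapeExt g (l + 1) ∨ shapeExt g l = shapeExt g (l + 1) + 1 := by
  have h := hg.2 ⟨l, hl⟩
  rwa [← shapeExt_val g, ← shapeExt_val g] at h

theorem shapeExt_bounds {n : ℕ} {g : Fin (n + 1) → ℕ} (hg : g ∈ shapes n) {l m : ℕ}
    (hlm : l ≤ m) (hm : m ≤ n) :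
    shapeExt g m ≤ shapeExt g l ∧ shapeExt g l ≤ shapeExt g m + (m - l) := by
  induction m, hlm using Nat.le_induction with
  | base => simp
  | succ m hlm ih =>
    have h1 := ih (by omega)
    have h2 := shapeExt_succ hg (show m < n by omega)
    omega

theorem shapeExt_last {n : ℕ} {g : Fin (n + 1) → ℕ} (hg : g ∈ shapes n) : shapeExt g n = 0 := by
  have h := shapeExt_val g (Fin.last n)
  rw [hg.1] at h
  exact h

/-- The step width of the levels. -/
def stepWidth (n : ℕ) : ℕ := Nat.sqrt (n * n.size) + 1

theorem lt_stepWidth_sq (n : ℕ) : n * n.size < stepWidth n * stepWidth n :=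
  Nat.lt_succ_sqrt _

theorem size_le_stepWidth (n : ℕ) : n.size ≤ stepWidth n := by
  have h1 := lt_stepWidth_sq n
  have h2 := Nat.mul_le_mul_right n.size (size_le_self n)
  by_contra! h
  have := Nat.mul_le_mul h.le h.le
  omega

/-- The step width balances the gap between levels against the cost, `O(log n)` bits each, of
describing them all. -/
theorem mul_size_le_stepWidth {n M : ℕ} (h : M * stepWidth n ≤ n) :
    M * n.size ≤ stepWidth n := by
  have h1 := lt_stepWidth_sq n
  have h2 := Nat.mul_le_mul_right n.size h
  by_contra! h3
  have h4 := Nat.mul_le_mul_right (stepWidth n) h3.le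
  nlinarith

theorem stepWidth_le (n : ℕ) :
    (stepWidth n : ℝ) ≤ 2 * Real.sqrt (n * Real.logb 2 n) + 2 := by
  have h1 : ((Nat.sqrt (n * n.size) : ℕ) : ℝ) ≤ Real.sqrt (n * Real.logb 2 n) + Real.sqrt n := by
    calc ((Nat.sqrt (n * n.size) : ℕ) : ℝ) ≤ Real.sqrt ((n * n.size : ℕ) : ℝ) :=
          Real.nat_sqrt_le_real_sqrt
      _ ≤ Real.sqrt (n * Real.logb 2 n + n) := by
          refine Real.sqrt_le_sqrt ?_
          push_cast
          nlinarith [size_le_logb_add_one n, Nat.cast_nonneg (α := ℝ) n]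
      _ ≤ _ := by
          have h3 := Real.sq_sqrt (mul_nonneg n.cast_nonneg (logb_natCast_nonneg n))
          have h4 := Real.sq_sqrt (Nat.cast_nonneg (α := ℝ) n)
          refine Real.sqrt_le_iff.2 ⟨by positivity, ?_⟩
          nlinarith [mul_nonneg (Real.sqrt_nonneg (n * Real.logb 2 n)) (Real.sqrt_nonneg (n : ℝ))]
  have h2 : Real.sqrt n ≤ Real.sqrt (n * Real.logb 2 n) + 1 := by
    rcases lt_or_ge n 2 with hn | hn
    · have h3 : Real.sqrt n ≤ 1 := by
        rw [Real.sqrt_le_one]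
        exact_mod_cast (show n ≤ 1 by omega)
      linarith [Real.sqrt_nonneg (n * Real.logb 2 n)]
    · have h3 : 1 ≤ Real.logb 2 n := by
        rw [Real.le_logb_iff_rpow_le (by norm_num) (by positivity), Real.rpow_one]
        exact_mod_cast hn
      have h4 : Real.sqrt n ≤ Real.sqrt (n * Real.logb 2 n) :=
        Real.sqrt_le_sqrt (by nlinarith [Nat.cast_nonneg (α := ℝ) n])
      linarith
  unfold stepWidth
  push_cast
  linarith

theorem exists_string_of_shape_nat {U : Str →. Str} (hU : IsReferenceMachine U)
    {𝒜 : Set (Finset Str)} (h1 : ContainsCubes 𝒜) (h2 : EqualLengths 𝒜)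
    (h3 : SimpleSlices U 𝒜) (h4 : PolynomialCovering 𝒜) :
    ∃ C : ℕ, ∀ n, 0 < n → ∀ g ∈ shapes n, ∃ x : Str, x.length = n ∧ ∀ l : Fin (n + 1),
      canonicalRD U 𝒜 x l ≤ g l + C * stepWidth n ∧
        g l ≤ canonicalRD U 𝒜 x l + C * stepWidth n := by
  obtain ⟨b, c, hb, hlev⟩ := exists_string_of_levels hU h1 h2 h3 h4
  obtain ⟨K, hK⟩ := exists_canonicalRD_le_add hU h1 h2 h3 h4
  refine ⟨10 * b + 2 * c + 10 + 4 * K + 20, fun n hn g hg => ?_⟩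
  set d := stepWidth n with hd
  set s := n.size with hs
  set a := b * (s + 1) with ha
  -- The largest `M` for which `n - 1 - M * (d + a)`, the last survival threshold, needs no
  -- truncation.
  set M := (n - 1) / (d + a) with hM
  have hspos : 0 < s := Nat.size_pos.2 hn
  have hdpos : 0 < d := Nat.succ_pos _
  have hMda : M * (d + a) ≤ n - 1 := Nat.div_mul_le_self _ _
  have hMlt : n - 1 < M * (d + a) + (d + a) := Nat.lt_div_mul_add (by omega)
  rw [mul_add] at hMda hMlt
  have hMs : M * s ≤ d := mul_size_le_stepWidth (by rw [← hd]; omega)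
  have hsd : s ≤ d := size_le_stepWidth n
  have hMd : M ≤ d := le_trans (Nat.le_mul_of_pos_right M hspos) hMs
  have ha_le : a ≤ 2 * b * d := by
    rw [ha]; nlinarith [Nat.mul_le_mul_left b hsd, Nat.mul_le_mul_left b (hspos.trans_le hsd)]
  have hMa_le : M * a ≤ 2 * b * d := by
    rw [ha]; nlinarith [Nat.mul_le_mul_left b hMs, Nat.mul_le_mul_left b hMd]
  set δ := a * M + 2 + 2 * M.size with hδ
  have hδ_le : δ ≤ 2 * b * d + 4 * d := by
    have := size_le_self M
    have h5 : M.size ≤ s := Nat.size_le_size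
      ((Nat.div_le_self _ _).trans (Nat.sub_le _ _))
    rw [hδ, mul_comm a M]
    nlinarith
  have hdata : IsLevelData n M a δ (fun j => n - j * d) (fun j => shapeExt g (n - j * d))
      (fun j => n - 1 - j * (d + a)) := by
    refine ⟨by simp, by simpa using shapeExt_last hg, fun j hj => ?_, fun i j hij => ?_,
      fun i j hij => ?_, fun i j hij => ?_, by positivity, le_rfl⟩
    · have h5 := Nat.mul_le_mul_right d hj
      have h6 := Nat.mul_le_mul_right a hj
      simp only [mul_add, mul_comm a j]
      omega
    · exact Nat.sub_le_sub_left (Nat.mul_le_mul_right d hij) n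
    · exact (shapeExt_bounds hg (Nat.sub_le_sub_left (Nat.mul_le_mul_right d hij) n)
        (Nat.sub_le _ _)).1
    · have h5 := Nat.mul_le_mul_right d hij
      have h6 := (shapeExt_bounds hg (Nat.sub_le_sub_left h5 n) (Nat.sub_le n (i * d))).2
      simp only
      omega
  obtain ⟨x, hx, hxl⟩ := hlev n M δ _ _ _ hdata
  refine ⟨x, hx, fun l => ?_⟩
  have hKd : K * (s + 1) ≤ 2 * K * d := by
    nlinarith [Nat.mul_le_mul_left K hsd, Nat.mul_le_mul_left K (hspos.trans_le hsd)]
  obtain ⟨hK1, hK2⟩ := hK x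
  rw [hx, ← hs] at hK1 hK2
  have hlevel : ∀ j ≤ M, shapeExt g (n - j * d) ≤ canonicalRD U 𝒜 x (n - j * d) + δ ∧
      canonicalRD U 𝒜 x (n - j * d) ≤
        shapeExt g (n - j * d) + (2 * c + 10) * d + 2 * K * d := by
    intro j hj
    rcases j with _ | j
    -- Level 0 is outside the construction: the shape vanishes there, and the cube gives the upper
    -- bound.
    · simp only [zero_mul, Nat.sub_zero, shapeExt_last hg]
      exact ⟨Nat.zero_le _, by omega⟩
    · obtain ⟨h5, h6⟩ := hxl j hj
      rw [← hs] at h6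
      refine ⟨h5, h6.trans ?_⟩
      have h7 : c * (s + 1) ≤ 2 * c * d := by
        nlinarith [Nat.mul_le_mul_left c hsd, Nat.mul_le_mul_left c (hspos.trans_le hsd)]
      have h8 : M * (8 * s + 2) ≤ 10 * d := by nlinarith
      have h9 : (2 * c + 10) * d = 2 * c * d + 10 * d := add_mul _ _ _
      omega
  have hl : (l : ℕ) ≤ n := Nat.lt_succ_iff.1 l.2
  -- Take the nearest level above `l`. Below the last level the distance is still bounded, since
  -- maximality of `M` gives `n - M * d ≤ d + a + M * a`.
  obtain ⟨j, hj, hlj, hjl⟩ : ∃ j ≤ M, (l : ℕ) ≤ n - j * d ∧ n - j * d ≤ l + (d + a + M * a) := by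
    rcases le_total ((n - l) / d) M with h | h
    · refine ⟨(n - l) / d, h, ?_, ?_⟩
      · have := Nat.div_mul_le_self (n - l) d
        omega
      · have := Nat.lt_div_mul_add hdpos (a := n - l)
        omega
    · refine ⟨M, le_rfl, ?_, by omega⟩
      have h5 := Nat.mul_le_mul_right d h
      have := Nat.div_mul_le_self (n - l) d
      omega
  obtain ⟨h5, h6⟩ := hlevel j hj
  have h7 := shapeExt_bounds hg hlj (Nat.sub_le _ _)
  have h8 := hK2 _ _ hlj (Nat.sub_le _ _)
  have h9 := canonicalRD_anti U h1 h2 h4 hlj (by rw [hx]; exact Nat.sub_le _ _)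
  rw [shapeExt_val] at h7
  have h10 : (10 * b + 2 * c + 10 + 4 * K + 20) * d = 5 * (2 * b * d) + (2 * c + 10) * d +
      2 * (2 * K * d) + 20 * d := by ring
  rw [h10]
  constructor <;> omega

theorem exists_string_of_shape {U : Str →. Str} (hU : IsReferenceMachine U)
    {𝒜 : Set (Finset Str)} (h1 : ContainsCubes 𝒜) (h2 : EqualLengths 𝒜)
    (h3 : SimpleSlices U 𝒜) (h4 : PolynomialCovering 𝒜) :
    ∃ c : ℝ, ∀ n : ℕ, ∀ g ∈ shapes n,
      ∃ x : Str, x.length = n ∧ ∀ l : Fin (n + 1),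
        |(canonicalRD U 𝒜 x l : ℝ) - (g l : ℝ)| ≤ c * Real.sqrt (n * Real.logb 2 n) + c := by
  obtain ⟨C, hC⟩ := exists_string_of_shape_nat hU h1 h2 h3 h4
  obtain ⟨K, hK⟩ := exists_canonicalRD_le_add hU h1 h2 h3 h4
  refine ⟨2 * C + K, fun n g hg => ?_⟩
  -- Level data require `t 0 + 1 = n`, so `n = 0` is treated separately.
  rcases Nat.eq_zero_or_pos n with rfl | hn
  · refine ⟨[], rfl, fun l => ?_⟩
    obtain rfl : l = Fin.last 0 := Fin.ext (by have := l.2; simp only [Fin.val_last]; omega)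
    have h5 := (hK []).1
    simp only [List.length_nil, Nat.size_zero, zero_add, mul_one] at h5
    have h6 : (canonicalRD U 𝒜 [] 0 : ℝ) ≤ K := by exact_mod_cast h5
    rw [hg.1]
    simp only [Fin.val_last, Nat.cast_zero, sub_zero, zero_mul, Real.sqrt_zero, mul_zero, zero_add]
    rw [abs_of_nonneg (by positivity)]
    have : (0 : ℝ) ≤ C := by positivity
    linarith
  · obtain ⟨x, hx, hxl⟩ := hC n hn g hg
    refine ⟨x, hx, fun l => ?_⟩
    have h5 : (canonicalRD U 𝒜 x l : ℝ) ≤ g l + C * stepWidth n := by exact_mod_cast (hxl l).1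
    have h6 : (g l : ℝ) ≤ canonicalRD U 𝒜 x l + C * stepWidth n := by exact_mod_cast (hxl l).2
    have h7 := mul_le_mul_of_nonneg_left (stepWidth_le n) (Nat.cast_nonneg (α := ℝ) C)
    have h8 : (0 : ℝ) ≤ K * Real.sqrt (n * Real.logb 2 n) := by positivity
    have h9 : (0 : ℝ) ≤ K := by positivity
    rw [abs_le]
    constructor <;> nlinarith

theorem theorem1 (U : Str →. Str) (hU : IsReferenceMachine U)
    (𝒜 : Set (Finset Str)) (h𝒜 : IsDistortionFamily 𝒜)
    (h1 : ContainsCubes 𝒜) (h2 : EqualLengths 𝒜)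
    (h3 : SimpleSlices U 𝒜) (h4 : PolynomialCovering 𝒜) :
    (∃ c : ℝ, ∀ n : ℕ, ∀ x : Str, x.length = n →
      ∃ g ∈ shapes n, ∀ l : Fin (n + 1),
        |(canonicalRD U 𝒜 x l : ℝ) - (g l : ℝ)| ≤ c * Real.logb 2 n + c) ∧
    (∃ c : ℝ, ∀ n : ℕ, ∀ g ∈ shapes n,
      ∃ x : Str, x.length = n ∧ ∀ l : Fin (n + 1),
        |(canonicalRD U 𝒜 x l : ℝ) - (g l : ℝ)| ≤ c * Real.sqrt (n * Real.logb 2 n) + c) :=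
  ⟨exists_shape_of_string hU h1 h2 h3 h4, exists_string_of_shape hU h1 h2 h3 h4⟩
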